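/- Write $\ell_0=x$, $\ell=\ell_1=\frac1{-\log x}$, $\ell_{j+1}=\ell\circ\ell_j$. Let $\widehat{\mathcal L}_j^\infty$ be the set of transseries $$\sum_{i_0\ge 0}\sum_{i_1\ge 0}\cdots\sum_{i_j\ge 0}a_{i_0\ldots i_j}\,x^{\alpha_{i_0}}\ell^{\alpha_{i_0i_1}}\cdots\ell_j^{\alpha_{i_0\cdots i_j}},\qquad a_{i_0\ldots i_j}\in\mathbb R,$$ where for every $k\le j$ and all $i_0,\dots,i_{k-1}$ the sequence $(\alpha_{i_0\cdots i_k})_{i_k}$ of real numbers is strictly increasing and tends to $+\infty$; let $\widehat{\mathcal L}_j$ be the subset of those with only positive powers of $x$, and let $\widehat{\mathcal L}\subset\widehat{\mathcal L}_1$ and $\widehat{\mathcal L}^\infty\subset\widehat{\mathcal L}_1^\infty$ be the subsets of those with only integer powers of $\ell$. Exponents are ordered lexicographically, and the leading term of a transseries is the one with the smallest exponent. Let $\widehat g\in\widehat{\mathcal L}$, $$\widehat g=a\,x^\alpha\ell^m+\text{h.o.t.},\qquad a>0,\ \alpha>0,\ m\in\mathbb Z,$$ and let $\mathcal S(\widehat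 g)\subset\mathbb R_{>0}\times\mathbb Z$ be the set of the exponents $(\beta,l)$ of the monomials $x^\beta\ell^l$ that occur in $\widehat g$. If $m\ne0$, let $\widetilde{\mathcal R}$ be the sub-semigroup of $\mathbb R_{\ge0}\times\mathbb Z\times\mathbb Z$ generated by $(\beta-\alpha,l-m,0)$ for $(\beta,l)\in\mathcal S(\widehat g)\setminus\{(\alpha,m)\}$ together with $(0,1,-1)$ and $(0,0,1)$. If $m=0$, let $\widetilde{\mathcal R}$ be the sub-semigroup of $\mathbb R_{\ge0}\times\mathbb Z$ generated by $(\beta-\alpha,l)$ for $(\beta,l)\in\mathcal S(\widehat g)\setminus\{(\alpha,0)\}$ together with $(0,1)$. Then $\widehat g$ has a unique two-sided inverse $\widehat g^{-1}$ with respect to formal composition of power-iterated logarithm transseries, and $\widehat g^{-1}\in\widehat{\mathcal L}_2$; if $m=0$, then $\widehat g^{-1}\in\widehat{\mathcal L}$. More precisely: 1. If $m\neq0$, then $$\widehat g^{-1}(x)=(a\alpha^m)^{-\frac1\alpha}\,(x\ell^{-m})^{\frac1\alpha}\,\bigl(1+\widehat R(x)\bigr),$$ where $\widehat R\in\widehat{\mathcal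 L}_2^\infty$, every exponent of $\widehat R$ is lexicographically greater than $(0,0,0)$, and the support of $\widehat R$ consists of monomials of the form $(x\ell^{-m})^{\frac\gamma\alpha}\ell^r\ell_2^s$ with $(\gamma,r,s)\in\widetilde{\mathcal R}$. 2. If $m=0$, then $$\widehat g^{-1}(x)=a^{-\frac1\alpha}\,x^{\frac1\alpha}\,\bigl(1+\widehat R(x)\bigr),$$ where $\widehat R\in\widehat{\mathcal L}^\infty$, every exponent of $\widehat R$ is lexicographically greater than $(0,0)$, and the support of $\widehat R$ consists of monomials of the form $x^{\frac\gamma\alpha}\ell^r$ with $(\gamma,r)\in\widetilde{\mathcal R}$. -/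

import Mathlib

noncomputable section

namespace LogTransseries

/-- Exponents of the monomials `x^(γ 0) * ℓ^(γ 1) * ℓ₂^(γ 2) * ⋯` (finitely many nonzero), ordered
lexicographically, the exponent of `x = ℓ₀` coming first. A larger exponent is a smaller monomial
as `x → 0+`. -/
abbrev Exponent : Type := Lex (ℕ →₀ ℝ)

/-- Power-iterated logarithm transseries: real formal sums of monomials with well-ordered support
(and monomials of every depth in iterated logarithms). -/
abbrev Transseries : Type := HahnSeries Exponent ℝ

/-- The exponent of the monomial `ℓ_j ^ r`. -/
def ellExp (j : ℕ) (r : ℝ) : Exponent := toLex (Finsupp.single j r)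

/-- The exponent of the monomial `x ^ a * ℓ ^ b * ℓ₂ ^ c`. -/
def expo (a b c : ℝ) : Exponent := ellExp 0 a + ellExp 1 b + ellExp 2 c

/-- The identity transseries `x`. -/
def idT : Transseries := HahnSeries.single (ellExp 0 1) 1

/-! ### The classes of transseries -/

/-- `S` consists of terms of a strictly increasing sequence of reals that tends to `+∞`. -/
def IsSequential (S : Set ℝ) : Prop :=
  ∃ u : ℕ → ℝ, StrictMono u ∧ Filter.Tendsto u Filter.atTop Filter.atTop ∧ S ⊆ Set.range u

/-- The class of the transseries
`∑_{i₀} ∑_{i₁} ⋯ ∑_{i_j} a_{i₀…i_j} x^{α_{i₀}} ℓ^{α_{i₀i₁}} ⋯ ℓ_j^{α_{i₀…i_j}}` in which, for each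
`k ≤ j` and each choice of `i₀, …, i_{k-1}`, the exponents `α_{i₀…i_k}` of `ℓ_k` form a strictly
increasing sequence in `i_k` tending to `+∞`. The choice of `i₀, …, i_{k-1}` is here the choice of
the exponents `p 0, …, p (k-1)` of `ℓ₀, …, ℓ_{k-1}`. -/
def LInfty (j : ℕ) : Set Transseries :=
  {f | (∀ n ∈ f.support, ∀ k, j < k → ofLex n k = 0) ∧
    ∀ k ≤ j, ∀ p : ℕ → ℝ,
      IsSequential {t | ∃ n ∈ f.support, (∀ i < k, ofLex n i = p i) ∧ ofLex n k = t}}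

/-- The infinitesimal transseries of `LInfty j`: only positive powers of `x`. -/
def LFin (j : ℕ) : Set Transseries :=
  {f ∈ LInfty j | ∀ n ∈ f.support, 0 < ofLex n 0}

/-- The elements of `LInfty 1` with only integer powers of `ℓ`. -/
def LHatInfty : Set Transseries :=
  {f ∈ LInfty 1 | ∀ n ∈ f.support, ∃ z : ℤ, ofLex n 1 = z}

/-- The elements of `LFin 1` with only integer powers of `ℓ`. -/
def LHat : Set Transseries :=
  {f ∈ LFin 1 | ∀ n ∈ f.support, ∃ z : ℤ, ofLex n 1 = z}

/-! ### Formal composition -/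

/-- A transseries that may be substituted for `x`: positive leading coefficient, and leading
monomial tending to `0`. -/
def IsPosInfinitesimal (h : Transseries) : Prop :=
  0 < h.leadingCoeff ∧ 0 < h.order

/-- The `ε` in `u = c * M * (1 + ε)`, where `c * M` is the leading term of `u`. -/
def relRem (u : Transseries) : Transseries :=
  HahnSeries.single (-u.order) (u.leadingCoeff)⁻¹ * u - 1

/-- `u ^ r = c ^ r * M ^ r * (1 + ε) ^ r`, for `u = c * M * (1 + ε)` with `c > 0`; the last factor
is the binomial series in `ε`. -/
def rpow (u : Transseries) (r : ℝ) : Transseries :=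
  HahnSeries.single (toLex (r • ofLex u.order)) (u.leadingCoeff ^ r) *
    PowerSeries.heval (relRem u) (PowerSeries.binomialSeries ℝ r)

/-- `log u = log c + log M + log (1 + ε)`, for `u = c * M * (1 + ε)` with `c > 0`; the last term is
the logarithmic series in `ε`, and `log ℓ_j = - 1 / ℓ_{j+1}`, so that
`log M = - ∑ j, γ j * ℓ_{j+1}⁻¹` for `M = ∏ j, ℓ_j ^ γ j`. -/
def log (u : Transseries) : Transseries :=
  HahnSeries.C (Real.log u.leadingCoeff) -
    (ofLex u.order).sum (fun j r => HahnSeries.single (ellExp (j + 1) (-1)) r) +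
    PowerSeries.heval (relRem u) (PowerSeries.log ℝ)

/-- `ℓ_j ∘ h`: `ℓ₀ ∘ h = h` and `ℓ_{j+1} ∘ h = 1 / (- log (ℓ_j ∘ h))`. -/
def ellComp (h : Transseries) : ℕ → Transseries
  | 0 => h
  | j + 1 => (-log (ellComp h j))⁻¹

/-- The composition with `h` of the monomial with exponent `n`, that is
`∏ j, (ℓ_j ∘ h) ^ n j`. -/
def monomialComp (h : Transseries) (n : Exponent) : Transseries :=
  (ofLex n).prod fun j r => rpow (ellComp h j) r

/-- `k` is the formal composition `f ∘ h`: `h` may be substituted for `x`, the family of the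
`f_n * (monomial n ∘ h)` is formally summable, and its sum is `k`. -/
def IsComp (f h k : Transseries) : Prop :=
  IsPosInfinitesimal h ∧
    ∃ s : HahnSeries.SummableFamily Exponent ℝ Exponent,
      (∀ n, s n = f.coeff n • monomialComp h n) ∧ s.hsum = k

/-- `h` is a (two-sided) inverse of `g` for formal composition. -/
def IsFormalInverse (g h : Transseries) : Prop :=
  IsComp g h idT ∧ IsComp h g idT

/-! ### The semigroup of exponents -/

/-- The pairs `(β, l)` such that `x ^ β * ℓ ^ l` occurs in `g`. -/
def supp (g : Transseries) : Set (ℝ × ℤ) :=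
  {p | g.coeff (expo p.1 p.2 0) ≠ 0}

/-- The semigroup of exponents for the leading monomial `x ^ α * ℓ ^ m`, `m ≠ 0`. -/
def semigroup (g : Transseries) (α : ℝ) (m : ℤ) : AddSubsemigroup (ℝ × ℤ × ℤ) :=
  AddSubsemigroup.closure
    ({q | ∃ p ∈ supp g \ {(α, m)}, q = (p.1 - α, p.2 - m, 0)} ∪ {(0, 1, -1), (0, 0, 1)})

/-- The semigroup of exponents for the leading monomial `x ^ α`. -/
def semigroupZero (g : Transseries) (α : ℝ) : AddSubsemigroup (ℝ × ℤ) :=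
  AddSubsemigroup.closure
    ({q | ∃ p ∈ supp g \ {(α, 0)}, q = (p.1 - α, p.2)} ∪ {(0, 1)})

end LogTransseries

end

noncomputable section

namespace LogTransseries

open HahnSeries PowerSeries SummableFamily

/-!
Composition with `g`, carried out on the monomials in `x`, `ℓ` and `ℓ₂`, extends to a strongly
linear endomorphism `Φ` of the field of transseries. The leading exponents of the images of the
monomials increase strictly in the lexicographic order. Hence `Φ` is injective, and the
coefficients of a solution of `Φ h = x` are determined one after the other by recursion on the
exponent. The exponents that turn up lie in a translate of the rescaled monoid generated by the
relative exponents of `g`, `ℓ ∘ g` and `ℓ₂ ∘ g`, which gives the support of `h`. Since `Φ` commutes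
with real powers and logarithms, `h ∘ g = x` implies `Φ (f ∘ h) = f`; in particular
`Φ (g ∘ h) = g = Φ x`, so that `g ∘ h = x` by injectivity.

The laws of `(1 + e) ^ r` for real `r` hold because all the coefficients are polynomials in `r`, so
that it is enough to check them at the natural numbers; `log (1 + e)` is the derivative at `r = 0`.
-/

/-! ### Real powers and logarithms of Hahn series -/

section SupportedIn

variable {Γ R : Type*} [AddCommMonoid Γ] [PartialOrder Γ] [IsOrderedCancelAddMonoid Γ]
  [CommSemiring R]

/-- The subalgebra of the Hahn series supported in an additive submonoid `M`. -/
def supportedIn (R : Type*) [CommSemiring R] (M : AddSubmonoid Γ) :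
    Subalgebra R (HahnSeries Γ R) where
  carrier := {f | f.support ⊆ M}
  mul_mem' {f g} hf hg := by
    refine support_mul_subset.trans ?_
    rintro _ ⟨a, ha, b, hb, rfl⟩
    exact M.add_mem (hf ha) (hg hb)
  add_mem' {f g} hf hg := (support_add_subset f g).trans (Set.union_subset hf hg)
  algebraMap_mem' r := by
    intro a ha
    rw [← HahnSeries.C_eq_algebraMap] at ha
    rw [eq_of_mem_support_single ha]
    exact M.zero_mem

theorem single_mem_supportedIn {M : AddSubmonoid Γ} {n : Γ} (hn : n ∈ M) (r : R) :
    single n r ∈ supportedIn R M := fun a ha => by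
  rw [eq_of_mem_support_single ha]
  exact hn

end SupportedIn

section Heval

variable {Γ R : Type*} [AddCommMonoid Γ] [LinearOrder Γ]

theorem orderTop_pos_iff [Zero R] {e : HahnSeries Γ R} :
    0 < e.orderTop ↔ ∀ n ∈ e.support, 0 < n := by
  refine ⟨fun h n hn => WithTop.coe_pos.mp (h.trans_le (orderTop_le_of_coeff_ne_zero hn)),
    fun h => ?_⟩
  by_cases h0 : e = 0
  · simp [h0]
  · exact (zero_lt_orderTop_iff h0).2 (h _ (by simpa using h0))

variable [IsOrderedCancelAddMonoid Γ] [CommRing R]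

theorem heval_mem_supportedIn {M : AddSubmonoid Γ} {e : HahnSeries Γ R}
    (he : e ∈ supportedIn R M) (f : PowerSeries R) : heval e f ∈ supportedIn R M := by
  rw [heval_apply]
  refine support_hsum_subset.trans (Set.iUnion_subset fun i => ?_)
  suffices powerSeriesFamily e f i ∈ supportedIn R M from this
  by_cases h : 0 < e.orderTop
  · rw [powerSeriesFamily_of_orderTop_pos h]
    exact Subalgebra.smul_mem _ (Subalgebra.pow_mem _ he _) _
  · rw [powerSeriesFamily_of_not_orderTop_pos h, powerSeriesFamily_of_orderTop_pos (by simp)]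
    exact Subalgebra.smul_mem _ (Subalgebra.pow_mem _ (Subalgebra.zero_mem _) _) _

theorem heval_zero (f : PowerSeries R) :
    heval (0 : HahnSeries Γ R) f = constantCoeff f • 1 :=
  powerSeriesFamily_hsum_zero f

theorem orderTop_heval_pos {e : HahnSeries Γ R} (he : 0 < e.orderTop) {f : PowerSeries R}
    (hf : constantCoeff f = 0) : 0 < (heval e f).orderTop := by
  refine orderTop_pos_iff.2 fun n hn => lt_of_le_of_ne ?_ ?_
  · exact heval_mem_supportedIn (M := AddSubmonoid.nonneg Γ)
      (fun m hm => (orderTop_pos_iff.1 he m hm).le) f hn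
  · rintro rfl
    exact hn (by rw [coeff_heval_zero, hf])

theorem orderTop_heval_sub_one_pos {e : HahnSeries Γ R} (he : 0 < e.orderTop) {f : PowerSeries R}
    (hf : constantCoeff f = 1) : 0 < (heval e f - 1).orderTop := by
  rw [← map_one (heval e), ← map_sub]
  exact orderTop_heval_pos he (by simp [hf])

theorem coeff_heval_mul_heval (e d : HahnSeries Γ R) (f g : PowerSeries R) (p : Γ) :
    (heval e f * heval d g).coeff p =
      ∑ i ∈ (((powers e).mul (powers d)).coeff p).support,
        f.coeff i.1 * g.coeff i.2 * (powers e i.1 * powers d i.2).coeff p := by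
  have hterm (i : ℕ × ℕ) : ((powerSeriesFamily e f).mul (powerSeriesFamily d g) i).coeff p =
      f.coeff i.1 * g.coeff i.2 * (powers e i.1 * powers d i.2).coeff p := by
    simp only [mul_toFun, smulFamily_toFun, smul_mul_smul_comm, HahnSeries.coeff_smul, smul_eq_mul]
  rw [heval_apply, heval_apply, ← hsum_mul, coeff_hsum_eq_sum_of_subset]
  · exact Finset.sum_congr rfl fun i _ => hterm i
  · intro i hi
    rw [Finset.mem_coe, Finsupp.mem_support_iff]
    intro h0
    have : (powers e i.1 * powers d i.2).coeff p = 0 := h0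
    exact hi ((hterm i).trans (by rw [this, mul_zero]))

theorem heval_binomialSeries_natCast [BinomialRing R] {e : HahnSeries Γ R} (he : 0 < e.orderTop)
    (n : ℕ) : heval e (binomialSeries R (n : R)) = (1 + e) ^ n := by
  rw [binomialSeries_nat, map_pow, map_add, map_one, heval_X e he]

theorem orderTop_add_add_mul_pos {e d : HahnSeries Γ R} (he : 0 < e.orderTop)
    (hd : 0 < d.orderTop) : 0 < (e + d + e * d).orderTop := by
  have h : 0 < (e * d).orderTop :=
    (he.trans_le (le_add_of_nonneg_right hd.le)).trans_le orderTop_add_le_mul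
  exact (lt_min (lt_min he hd) h).trans_le
    ((min_le_min_right _ min_orderTop_le_orderTop_add).trans min_orderTop_le_orderTop_add)

end Heval

section PolynomialFamily

variable {K Γ : Type*} [Field K] [LinearOrder Γ] {F G : K → HahnSeries Γ K}
  {D E : HahnSeries Γ K}

/-- The coefficients of `F r` are polynomials in `r`, and those of `D` are their derivatives
at `r = 0`. For `F r = (1 + e) ^ r` the latter is `log (1 + e)`. -/
def IsPolynomialFamily (F : K → HahnSeries Γ K) (D : HahnSeries Γ K) : Prop :=
  ∀ p, ∃ P : Polynomial K, (∀ r, (F r).coeff p = P.eval r) ∧ P.derivative.eval 0 = D.coeff p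

namespace IsPolynomialFamily

theorem comp_mul (hF : IsPolynomialFamily F D) (c : K) :
    IsPolynomialFamily (fun r => F (c * r)) (c • D) := fun p => by
  obtain ⟨P, hP, hD⟩ := hF p
  refine ⟨P.comp (Polynomial.C c * Polynomial.X), fun r => by simp [hP], ?_⟩
  rw [HahnSeries.coeff_smul, ← hD, Polynomial.derivative_comp]
  simp

variable [CharZero K]

theorem ext_natCast (hF : IsPolynomialFamily F D) (hG : IsPolynomialFamily G E)
    (h : ∀ n : ℕ, F n = G n) : F = G := by
  ext r p
  obtain ⟨P, hP, -⟩ := hF p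
  obtain ⟨Q, hQ, -⟩ := hG p
  have : P = Q := Polynomial.eq_of_infinite_eval_eq P Q <|
    (Set.infinite_range_of_injective Nat.cast_injective).mono <| by
      rintro _ ⟨n, rfl⟩
      rw [Set.mem_ofPred_eq, ← hP, ← hQ, h]
  rw [hP, hQ, this]

theorem derivative_unique (hD : IsPolynomialFamily F D) (hE : IsPolynomialFamily F E) :
    D = E := by
  ext p
  obtain ⟨P, hP, hPD⟩ := hD p
  obtain ⟨Q, hQ, hQE⟩ := hE p
  have : P = Q := Polynomial.funext fun r => by rw [← hP, ← hQ]
  rw [← hPD, ← hQE, this]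

end IsPolynomialFamily

end PolynomialFamily

section BinomialSeries

variable {K : Type*} [Field K]

/-- The binomial coefficient `r.choose n` as a polynomial in `r`. -/
def choosePoly (K : Type*) [Field K] (n : ℕ) : Polynomial K :=
  Polynomial.C ((n.factorial : K)⁻¹) * descPochhammer K n

theorem descPochhammer_eval_neg_one (n : ℕ) :
    (descPochhammer K n).eval (-1) = (-1) ^ n * n.factorial := by
  induction n with
  | zero => simp
  | succ n ih =>
    rw [descPochhammer_succ_eval, ih, Nat.factorial_succ]
    push_cast
    ring

variable [CharZero K]

theorem eval_choosePoly (n : ℕ) (r : K) : (choosePoly K n).eval r = Ring.choose r n := by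
  rw [Ring.choose_eq_smul, choosePoly, Polynomial.eval_C_mul, smul_eq_mul,
    ← Polynomial.aeval_eq_smeval, Polynomial.aeval_def, ← Polynomial.eval_map, descPochhammer_map]

theorem derivative_choosePoly_eval_zero (n : ℕ) :
    (choosePoly K n).derivative.eval 0 = (PowerSeries.log K).coeff n := by
  cases n with
  | zero => simp [choosePoly]
  | succ n =>
    rw [choosePoly, Polynomial.derivative_C_mul, Polynomial.eval_C_mul, descPochhammer_succ_left,
      Polynomial.derivative_mul]
    simp only [Polynomial.derivative_X, one_mul, Polynomial.eval_add, Polynomial.eval_comp,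
      Polynomial.eval_mul, Polynomial.eval_X, zero_mul, add_zero, Polynomial.eval_sub,
      Polynomial.eval_one, zero_sub, descPochhammer_eval_neg_one, PowerSeries.coeff_log,
      Nat.factorial_succ, if_neg n.succ_ne_zero]
    have : (n.factorial : K) ≠ 0 := Nat.cast_ne_zero.2 n.factorial_ne_zero
    have : (n + 1 : K) ≠ 0 := Nat.cast_add_one_ne_zero n
    push_cast
    field_simp
    ring

variable {Γ : Type*} [LinearOrder Γ] [AddCommMonoid Γ] [IsOrderedCancelAddMonoid Γ]
  {e d : HahnSeries Γ K}

theorem isPolynomialFamily_heval_mul_heval (e d : HahnSeries Γ K) :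
    IsPolynomialFamily (fun r : K => heval e (binomialSeries K r) * heval d (binomialSeries K r))
      (heval e (PowerSeries.log K) + heval d (PowerSeries.log K)) := by
  refine fun p => ⟨∑ i ∈ (((powers e).mul (powers d)).coeff p).support,
    Polynomial.C ((powers e i.1 * powers d i.2).coeff p) * (choosePoly K i.1 * choosePoly K i.2),
    fun r => ?_, ?_⟩
  · rw [coeff_heval_mul_heval, Polynomial.eval_finsetSum]
    refine Finset.sum_congr rfl fun i _ => ?_
    simp [eval_choosePoly, mul_comm]
  · have hlog_e := coeff_heval_mul_heval e d (PowerSeries.log K) 1 p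
    have hlog_d := coeff_heval_mul_heval e d 1 (PowerSeries.log K) p
    rw [map_one, mul_one] at hlog_e
    rw [map_one, one_mul] at hlog_d
    rw [HahnSeries.coeff_add, hlog_e, hlog_d, Polynomial.derivative_sum,
      Polynomial.eval_finsetSum, ← Finset.sum_add_distrib]
    refine Finset.sum_congr rfl fun i _ => ?_
    have h0 (n : ℕ) : (choosePoly K n).eval 0 = (1 : PowerSeries K).coeff n := by
      rw [eval_choosePoly, Ring.choose_zero_ite, PowerSeries.coeff_one]
    rw [Polynomial.derivative_C_mul, Polynomial.eval_C_mul, Polynomial.derivative_mul]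
    simp only [Polynomial.eval_add, Polynomial.eval_mul, derivative_choosePoly_eval_zero, h0]
    ring

theorem isPolynomialFamily_heval (e : HahnSeries Γ K) :
    IsPolynomialFamily (fun r : K => heval e (binomialSeries K r))
      (heval e (PowerSeries.log K)) := by
  simpa only [heval_zero, binomialSeries_constantCoeff, PowerSeries.constantCoeff_log, one_smul,
    zero_smul, mul_one, add_zero] using isPolynomialFamily_heval_mul_heval e 0

theorem heval_binomialSeries_add_add_mul (he : 0 < e.orderTop) (hd : 0 < d.orderTop) :
    (fun r : K => heval (e + d + e * d) (binomialSeries K r)) =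
      fun r : K => heval e (binomialSeries K r) * heval d (binomialSeries K r) := by
  refine (isPolynomialFamily_heval _).ext_natCast (isPolynomialFamily_heval_mul_heval e d)
    fun n => ?_
  rw [heval_binomialSeries_natCast (orderTop_add_add_mul_pos he hd),
    heval_binomialSeries_natCast he, heval_binomialSeries_natCast hd, ← mul_pow]
  congr 1
  ring

theorem heval_log_add_add_mul (he : 0 < e.orderTop) (hd : 0 < d.orderTop) :
    heval (e + d + e * d) (PowerSeries.log K) =
      heval e (PowerSeries.log K) + heval d (PowerSeries.log K) := by
  have h := isPolynomialFamily_heval (e + d + e * d)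
  rw [heval_binomialSeries_add_add_mul he hd] at h
  exact h.derivative_unique (isPolynomialFamily_heval_mul_heval e d)

theorem binomialSeries_mul_natCast (r : K) (n : ℕ) :
    binomialSeries K (r * n) = binomialSeries K r ^ n := by
  induction n with
  | zero => simp
  | succ n ih => rw [Nat.cast_succ, mul_add, mul_one, binomialSeries_add, ih, pow_succ]

theorem heval_binomialSeries_comp (he : 0 < e.orderTop) (r : K) :
    (fun s : K => heval (heval e (binomialSeries K r) - 1) (binomialSeries K s)) =
      fun s : K => heval e (binomialSeries K (r * s)) := by
  refine (isPolynomialFamily_heval _).ext_natCast ((isPolynomialFamily_heval e).comp_mul r)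
    fun n => ?_
  rw [heval_binomialSeries_natCast
      (orderTop_heval_sub_one_pos he (binomialSeries_constantCoeff r)),
    add_sub_cancel, ← map_pow, binomialSeries_mul_natCast]

theorem heval_log_comp (he : 0 < e.orderTop) (r : K) :
    heval (heval e (binomialSeries K r) - 1) (PowerSeries.log K) =
      r • heval e (PowerSeries.log K) := by
  have h := isPolynomialFamily_heval (heval e (binomialSeries K r) - 1)
  rw [heval_binomialSeries_comp he] at h
  exact h.derivative_unique ((isPolynomialFamily_heval e).comp_mul r)

end BinomialSeries

/-! ### Real powers and logarithms of transseries -/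

section Exponents

theorem exponent_ext {n k : Exponent} (h : ∀ j, ofLex n j = ofLex k j) : n = k :=
  ofLex.injective (Finsupp.ext h)

theorem ofLex_zero_apply (j : ℕ) : ofLex (0 : Exponent) j = 0 := rfl

theorem ofLex_add_apply (n k : Exponent) (j : ℕ) : ofLex (n + k) j = ofLex n j + ofLex k j := rfl

theorem ofLex_smul_apply (r : ℝ) (n : Exponent) (j : ℕ) : ofLex (r • n) j = r * ofLex n j := rfl

theorem ofLex_ellExp_apply (i : ℕ) (r : ℝ) (j : ℕ) :
    ofLex (ellExp i r) j = if i = j then r else 0 := Finsupp.single_apply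

theorem ofLex_expo_apply (a b c : ℝ) (j : ℕ) :
    ofLex (expo a b c) j = (if 0 = j then a else 0) + (if 1 = j then b else 0) +
      (if 2 = j then c else 0) := by
  simp only [expo, ofLex_add_apply, ofLex_ellExp_apply]

theorem ofLex_expo_zero (a b c : ℝ) : ofLex (expo a b c) 0 = a := by
  simp [ofLex_expo_apply]

theorem ofLex_expo_one (a b c : ℝ) : ofLex (expo a b c) 1 = b := by
  simp [ofLex_expo_apply]

theorem ofLex_expo_two (a b c : ℝ) : ofLex (expo a b c) 2 = c := by
  simp [ofLex_expo_apply]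

theorem ellExp_zero (j : ℕ) : ellExp j 0 = 0 := by
  rw [ellExp, Finsupp.single_zero, toLex_zero]

theorem ellExp_add (j : ℕ) (r s : ℝ) : ellExp j (r + s) = ellExp j r + ellExp j s := by
  simp only [ellExp, Finsupp.single_add, toLex_add]

theorem neg_ellExp (j : ℕ) (r : ℝ) : -ellExp j r = ellExp j (-r) := by
  simp only [ellExp, Finsupp.single_neg, toLex_neg]

theorem smul_ellExp (j : ℕ) (r s : ℝ) : r • ellExp j s = ellExp j (r * s) :=
  exponent_ext fun i => by
    rw [ofLex_smul_apply, ofLex_ellExp_apply, ofLex_ellExp_apply, mul_ite, mul_zero]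

theorem expo_zero (a b : ℝ) : expo a b 0 = ellExp 0 a + ellExp 1 b := by
  rw [expo, ellExp_zero, add_zero]

theorem ellExp_add_ellExp_succ_pos (j : ℕ) {r : ℝ} (hr : 0 < r) (s : ℝ) :
    0 < ellExp j r + ellExp (j + 1) s := by
  refine Finsupp.Lex.lt_iff.2 ⟨j, fun i hi => ?_, ?_⟩
  · rw [ofLex_add_apply, ofLex_ellExp_apply, ofLex_ellExp_apply, if_neg hi.ne',
      if_neg (by omega), ofLex_zero_apply, add_zero]
  · rwa [ofLex_add_apply, ofLex_ellExp_apply, ofLex_ellExp_apply, if_pos rfl,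
      if_neg (by omega), ofLex_zero_apply, add_zero]

theorem ellExp_pos (j : ℕ) {r : ℝ} (hr : 0 < r) : 0 < ellExp j r := by
  simpa only [ellExp_zero, add_zero] using ellExp_add_ellExp_succ_pos j hr 0

end Exponents

section Decomposition

variable {u v : Transseries}

theorem eq_single_mul_one_add_relRem (hu : u ≠ 0) :
    u = HahnSeries.single u.order u.leadingCoeff * (1 + relRem u) := by
  rw [relRem, add_sub_cancel, ← mul_assoc, single_mul_single, add_neg_cancel,
    mul_inv_cancel₀ (leadingCoeff_ne_zero.2 hu), single_zero_one, one_mul]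

theorem orderTop_relRem_pos (hu : u ≠ 0) : 0 < (relRem u).orderTop := by
  have hc := leadingCoeff_ne_zero.2 hu
  rw [relRem, orderTop_self_sub_one_pos_iff]
  constructor
  · rw [orderTop_mul, orderTop_single (inv_ne_zero hc), ← order_eq_orderTop_of_ne_zero hu,
      ← WithTop.coe_add, neg_add_cancel, WithTop.coe_zero]
  · rw [leadingCoeff_mul, leadingCoeff_of_single, inv_mul_cancel₀ hc]

variable {n : Exponent} {c : ℝ} {e : Transseries}

theorem leadingCoeff_one_add (he : 0 < e.orderTop) : (1 + e).leadingCoeff = 1 :=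
  ((orderTop_self_sub_one_pos_iff (1 + e)).1 (by rwa [add_sub_cancel_left])).2

theorem order_one_add (he : 0 < e.orderTop) : (1 + e).order = 0 := by
  have h := (orderTop_self_sub_one_pos_iff (1 + e)).1 (by rwa [add_sub_cancel_left])
  have h0 : 1 + e ≠ 0 := leadingCoeff_ne_zero.1 (h.2.trans_ne one_ne_zero)
  exact_mod_cast (order_eq_orderTop_of_ne_zero h0).trans h.1

theorem leadingCoeff_single_mul (he : 0 < e.orderTop) :
    (HahnSeries.single n c * (1 + e)).leadingCoeff = c := by
  rw [leadingCoeff_mul, leadingCoeff_of_single, leadingCoeff_one_add he, mul_one]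

theorem order_single_mul (hc : c ≠ 0) (he : 0 < e.orderTop) :
    (HahnSeries.single n c * (1 + e)).order = n := by
  have h0 : 1 + e ≠ 0 := leadingCoeff_ne_zero.1 ((leadingCoeff_one_add he).trans_ne one_ne_zero)
  rw [order_mul (single_ne_zero hc) h0, order_single hc, order_one_add he, add_zero]

theorem relRem_single_mul (hc : c ≠ 0) (he : 0 < e.orderTop) :
    relRem (HahnSeries.single n c * (1 + e)) = e := by
  rw [relRem, leadingCoeff_single_mul he, order_single_mul hc he, ← mul_assoc, single_mul_single,
    neg_add_cancel, inv_mul_cancel₀ hc, single_zero_one, one_mul, add_sub_cancel_left]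

theorem relRem_mul (hu : u ≠ 0) (hv : v ≠ 0) :
    relRem (u * v) = relRem u + relRem v + relRem u * relRem v := by
  have h : u * v = HahnSeries.single (u.order + v.order) (u.leadingCoeff * v.leadingCoeff) *
      (1 + (relRem u + relRem v + relRem u * relRem v)) := by
    conv_lhs => rw [eq_single_mul_one_add_relRem hu, eq_single_mul_one_add_relRem hv]
    rw [← single_mul_single]
    ring
  rw [h, relRem_single_mul (mul_ne_zero (leadingCoeff_ne_zero.2 hu) (leadingCoeff_ne_zero.2 hv))
    (orderTop_add_add_mul_pos (orderTop_relRem_pos hu) (orderTop_relRem_pos hv))]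

theorem ne_zero_of_leadingCoeff_pos (hu : 0 < u.leadingCoeff) : u ≠ 0 :=
  leadingCoeff_ne_zero.1 hu.ne'

theorem leadingCoeff_mul_pos (hu : 0 < u.leadingCoeff) (hv : 0 < v.leadingCoeff) :
    0 < (u * v).leadingCoeff := by
  rw [leadingCoeff_mul]
  exact mul_pos hu hv

end Decomposition

section Rpow

variable {u v : Transseries}

theorem rpow_eq_single_smul_mul (u : Transseries) (r : ℝ) : rpow u r =
    HahnSeries.single (r • u.order) (u.leadingCoeff ^ r) *
      heval (relRem u) (binomialSeries ℝ r) := rfl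

theorem rpow_eq_single_mul_one_add (u : Transseries) (r : ℝ) : rpow u r =
    HahnSeries.single (r • u.order) (u.leadingCoeff ^ r) *
      (1 + (heval (relRem u) (binomialSeries ℝ r) - 1)) := by
  rw [add_sub_cancel, rpow_eq_single_smul_mul]

theorem orderTop_heval_binomialSeries_sub_one_pos {e : Transseries} (he : 0 < e.orderTop) (r : ℝ) :
    0 < (heval e (binomialSeries ℝ r) - 1).orderTop :=
  orderTop_heval_sub_one_pos he (binomialSeries_constantCoeff r)

theorem leadingCoeff_rpow (hu : u ≠ 0) (r : ℝ) : (rpow u r).leadingCoeff = u.leadingCoeff ^ r := by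
  rw [rpow_eq_single_mul_one_add, leadingCoeff_single_mul
    (orderTop_heval_binomialSeries_sub_one_pos (orderTop_relRem_pos hu) r)]

theorem leadingCoeff_rpow_pos (hu : 0 < u.leadingCoeff) (r : ℝ) :
    0 < (rpow u r).leadingCoeff := by
  rw [leadingCoeff_rpow (ne_zero_of_leadingCoeff_pos hu)]
  exact Real.rpow_pos_of_pos hu r

theorem order_rpow (hu : 0 < u.leadingCoeff) (r : ℝ) : (rpow u r).order = r • u.order := by
  rw [rpow_eq_single_mul_one_add, order_single_mul (Real.rpow_pos_of_pos hu r).ne'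
    (orderTop_heval_binomialSeries_sub_one_pos
      (orderTop_relRem_pos (ne_zero_of_leadingCoeff_pos hu)) r)]

theorem relRem_rpow (hu : 0 < u.leadingCoeff) (r : ℝ) :
    relRem (rpow u r) = heval (relRem u) (binomialSeries ℝ r) - 1 := by
  rw [rpow_eq_single_mul_one_add, relRem_single_mul (Real.rpow_pos_of_pos hu r).ne'
    (orderTop_heval_binomialSeries_sub_one_pos
      (orderTop_relRem_pos (ne_zero_of_leadingCoeff_pos hu)) r)]

theorem rpow_zero (u : Transseries) : rpow u 0 = 1 := by
  have h : (0 : ℝ) • u.order = 0 := zero_smul ℝ (ofLex u.order)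
  rw [rpow_eq_single_smul_mul, h, Real.rpow_zero, binomialSeries_zero, map_one (heval (relRem u)),
    mul_one, single_zero_one]

theorem rpow_one (hu : u ≠ 0) : rpow u 1 = u := by
  have h := heval_binomialSeries_natCast (orderTop_relRem_pos hu) 1
  rw [Nat.cast_one, pow_one] at h
  conv_rhs => rw [eq_single_mul_one_add_relRem hu]
  rw [rpow_eq_single_smul_mul, h, one_smul, Real.rpow_one]

theorem rpow_add (hu : 0 < u.leadingCoeff) (r s : ℝ) :
    rpow u (r + s) = rpow u r * rpow u s := by
  have h : (r + s) • u.order = r • u.order + s • u.order := add_smul r s (ofLex u.order)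
  simp only [rpow_eq_single_smul_mul]
  rw [h, Real.rpow_add hu, ← single_mul_single, binomialSeries_add, map_mul]
  ring

theorem rpow_mul (hu : 0 < u.leadingCoeff) (hv : 0 < v.leadingCoeff) (r : ℝ) :
    rpow (u * v) r = rpow u r * rpow v r := by
  have hu0 := ne_zero_of_leadingCoeff_pos hu
  have hv0 := ne_zero_of_leadingCoeff_pos hv
  have h := congrFun (heval_binomialSeries_add_add_mul (orderTop_relRem_pos hu0)
    (orderTop_relRem_pos hv0)) r
  simp only [rpow_eq_single_smul_mul]
  rw [order_mul hu0 hv0, smul_add, leadingCoeff_mul, Real.mul_rpow hu.le hv.le,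
    ← single_mul_single, relRem_mul hu0 hv0, h]
  ring

theorem rpow_rpow (hu : 0 < u.leadingCoeff) (r s : ℝ) : rpow (rpow u r) s = rpow u (r * s) := by
  have hu0 := ne_zero_of_leadingCoeff_pos hu
  have h := congrFun (heval_binomialSeries_comp (orderTop_relRem_pos hu0) r) s
  rw [rpow_eq_single_smul_mul (rpow u r), rpow_eq_single_smul_mul u (r * s), order_rpow hu,
    leadingCoeff_rpow hu0, relRem_rpow hu, h, Real.rpow_mul hu.le, smul_smul, mul_comm s r]

theorem rpow_neg (hu : 0 < u.leadingCoeff) (r : ℝ) : rpow u (-r) = (rpow u r)⁻¹ :=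
  eq_inv_of_mul_eq_one_left (by rw [← rpow_add hu, neg_add_cancel, rpow_zero])

theorem rpow_neg_one (hu : 0 < u.leadingCoeff) : rpow u (-1) = u⁻¹ := by
  rw [rpow_neg hu, rpow_one (ne_zero_of_leadingCoeff_pos hu)]

theorem rpow_single_mul {n : Exponent} {c : ℝ} {e : Transseries} (hc : c ≠ 0)
    (he : 0 < e.orderTop) (r : ℝ) : rpow (HahnSeries.single n c * (1 + e)) r =
      HahnSeries.single (r • n) (c ^ r) * heval e (binomialSeries ℝ r) := by
  rw [rpow_eq_single_smul_mul, leadingCoeff_single_mul he, order_single_mul hc he,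
    relRem_single_mul hc he]

theorem relRem_single (n : Exponent) {c : ℝ} (hc : c ≠ 0) : relRem (HahnSeries.single n c) = 0 := by
  simpa using relRem_single_mul (n := n) (e := 0) hc (by simp)

theorem rpow_single (n : Exponent) {c : ℝ} (hc : c ≠ 0) (r : ℝ) :
    rpow (HahnSeries.single n c) r = HahnSeries.single (r • n) (c ^ r) := by
  rw [rpow_eq_single_smul_mul, order_single hc, leadingCoeff_of_single, relRem_single n hc,
    heval_zero, binomialSeries_constantCoeff, one_smul, mul_one]

end Rpow

section Log

variable {u v : Transseries}

/-- `-log M` for the monomial `M` with exponent `n`. -/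
def negLogMonomial (n : Exponent) : Transseries :=
  (ofLex n).sum (fun j r => HahnSeries.single (ellExp (j + 1) (-1)) r)

theorem negLogMonomial_add (n k : Exponent) :
    negLogMonomial (n + k) = negLogMonomial n + negLogMonomial k := by
  unfold negLogMonomial
  rw [ofLex_add, Finsupp.sum_add_index'] <;> simp

theorem negLogMonomial_smul (r : ℝ) (n : Exponent) :
    negLogMonomial (r • n) = r • negLogMonomial n := by
  unfold negLogMonomial
  rw [ofLex_smul, Finsupp.sum_smul_index (by simp), Finsupp.smul_sum]
  refine Finsupp.sum_congr fun j _ => ?_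
  ext p
  simp [coeff_single]

theorem negLogMonomial_ellExp (j : ℕ) (r : ℝ) :
    negLogMonomial (ellExp j r) = HahnSeries.single (ellExp (j + 1) (-1)) r := by
  unfold negLogMonomial ellExp
  rw [ofLex_toLex, Finsupp.sum_single_index (by simp)]

theorem log_eq (u : Transseries) : log u = HahnSeries.C (Real.log u.leadingCoeff) -
    negLogMonomial u.order + heval (relRem u) (PowerSeries.log ℝ) := rfl

theorem log_mul (hu : u ≠ 0) (hv : v ≠ 0) : log (u * v) = log u + log v := by
  rw [log_eq, log_eq, log_eq, order_mul hu hv, negLogMonomial_add, leadingCoeff_mul,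
    Real.log_mul (leadingCoeff_ne_zero.2 hu) (leadingCoeff_ne_zero.2 hv), map_add,
    relRem_mul hu hv, heval_log_add_add_mul (orderTop_relRem_pos hu) (orderTop_relRem_pos hv)]
  ring

theorem log_rpow (hu : 0 < u.leadingCoeff) (r : ℝ) : log (rpow u r) = r • log u := by
  have hu0 := ne_zero_of_leadingCoeff_pos hu
  rw [log_eq, log_eq, order_rpow hu, leadingCoeff_rpow hu0, relRem_rpow hu,
    negLogMonomial_smul, heval_log_comp (orderTop_relRem_pos hu0), Real.log_rpow hu, smul_add,
    smul_sub, ← HahnSeries.C_mul_eq_smul (x := HahnSeries.C (Real.log u.leadingCoeff)), map_mul]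

theorem log_single_mul {n : Exponent} {c : ℝ} {e : Transseries} (hc : c ≠ 0)
    (he : 0 < e.orderTop) : log (HahnSeries.single n c * (1 + e)) =
      HahnSeries.C (Real.log c) - negLogMonomial n + heval e (PowerSeries.log ℝ) := by
  rw [log_eq, leadingCoeff_single_mul he, order_single_mul hc he, relRem_single_mul hc he]

theorem log_single (n : Exponent) {c : ℝ} (hc : c ≠ 0) :
    log (HahnSeries.single n c) = HahnSeries.C (Real.log c) - negLogMonomial n := by
  rw [log_eq, leadingCoeff_of_single, order_single hc, relRem_single n hc, heval_zero,
    constantCoeff_log, zero_smul, add_zero]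

end Log

section InvNegLog

/-- The `e` in `-log u = a * ℓ_{j+1}⁻¹ * (1 + e)`, where the leading monomial of `u` is
`ℓ_j ^ a * ℓ_{j+1} ^ b`. -/
def logRem (j : ℕ) (a b : ℝ) (u : Transseries) : Transseries :=
  HahnSeries.single (ellExp (j + 1) 1) (-a⁻¹ * Real.log u.leadingCoeff) +
    HahnSeries.single (ellExp (j + 1) 1 + ellExp (j + 2) (-1)) (a⁻¹ * b) -
    HahnSeries.single (ellExp (j + 1) 1) a⁻¹ * heval (relRem u) (PowerSeries.log ℝ)

variable {j : ℕ} {a b : ℝ} {u : Transseries}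

theorem neg_log_eq (ha : a ≠ 0) (hu : u.order = ellExp j a + ellExp (j + 1) b) :
    -log u = HahnSeries.single (ellExp (j + 1) (-1)) a * (1 + logRem j a b u) := by
  have hC : HahnSeries.single (0 : Exponent) (Real.log u.leadingCoeff) =
    HahnSeries.C (Real.log u.leadingCoeff) := rfl
  rw [log_eq, hu, negLogMonomial_add, negLogMonomial_ellExp, negLogMonomial_ellExp, logRem,
    mul_add, mul_sub, mul_add, ← mul_assoc, single_mul_single, single_mul_single,
    single_mul_single, ← neg_ellExp, neg_add_cancel, neg_add_cancel_left, mul_inv_cancel₀ ha,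
    single_zero_one, one_mul, mul_one, mul_inv_cancel_left₀ ha, ← mul_assoc, mul_neg,
    mul_inv_cancel₀ ha, neg_one_mul, neg_ellExp, single_neg, hC]
  ring

theorem logRem_mem_supportedIn {M : AddSubmonoid Exponent} (hu : relRem u ∈ supportedIn ℝ M)
    (hell : ellExp (j + 1) 1 ∈ M) (hb : b = 0 ∨ ellExp (j + 1) 1 + ellExp (j + 2) (-1) ∈ M) :
    logRem j a b u ∈ supportedIn ℝ M := by
  refine Subalgebra.sub_mem _ (Subalgebra.add_mem _ (single_mem_supportedIn hell _) ?_)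
    (Subalgebra.mul_mem _ (single_mem_supportedIn hell _) (heval_mem_supportedIn hu _))
  rcases hb with rfl | hb
  · rw [mul_zero, single_eq_zero]
    exact Subalgebra.zero_mem _
  · exact single_mem_supportedIn hb _

theorem orderTop_logRem_pos (hu : u ≠ 0) : 0 < (logRem j a b u).orderTop := by
  have hell : 0 < ellExp (j + 1) 1 := ellExp_pos _ one_pos
  have hsingle {n : Exponent} (r : ℝ) (hn : 0 < n) : 0 < (HahnSeries.single n r).orderTop :=
    (WithTop.coe_pos.2 hn).trans_le orderTop_single_le
  have hmul : 0 < (HahnSeries.single (ellExp (j + 1) 1) a⁻¹ *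
      heval (relRem u) (PowerSeries.log ℝ)).orderTop := by
    rw [orderTop_mul]
    exact (hsingle _ hell).trans_le (le_add_of_nonneg_right
      (orderTop_heval_pos (orderTop_relRem_pos hu) constantCoeff_log).le)
  exact (lt_min (lt_min (hsingle _ hell)
      (hsingle _ (ellExp_add_ellExp_succ_pos _ one_pos _))) hmul).trans_le
    ((min_le_min_right _ min_orderTop_le_orderTop_add).trans min_orderTop_le_orderTop_sub)

theorem ne_zero_of_order_eq (ha : 0 < a) (hu : u.order = ellExp j a + ellExp (j + 1) b) :
    u ≠ 0 := by
  rintro rfl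
  exact (ellExp_add_ellExp_succ_pos j ha b).ne (order_zero.symm.trans hu)

theorem inv_neg_log_eq (ha : 0 < a) (hu : u.order = ellExp j a + ellExp (j + 1) b) :
    (-log u)⁻¹ = HahnSeries.single (ellExp (j + 1) 1) a⁻¹ *
      (1 + (heval (logRem j a b u) (binomialSeries ℝ (-1 : ℝ)) - 1)) := by
  have hpos := orderTop_logRem_pos (j := j) (a := a) (b := b) (ne_zero_of_order_eq ha hu)
  rw [← rpow_neg_one (by rwa [neg_log_eq ha.ne' hu, leadingCoeff_single_mul hpos]),
    neg_log_eq ha.ne' hu, rpow_single_mul ha.ne' hpos, smul_ellExp, Real.rpow_neg_one,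
    add_sub_cancel, neg_one_mul, neg_neg]

theorem leadingCoeff_inv_neg_log (ha : 0 < a) (hu : u.order = ellExp j a + ellExp (j + 1) b) :
    (-log u)⁻¹.leadingCoeff = a⁻¹ := by
  rw [inv_neg_log_eq ha hu, leadingCoeff_single_mul (orderTop_heval_binomialSeries_sub_one_pos
    (orderTop_logRem_pos (ne_zero_of_order_eq ha hu)) _)]

theorem order_inv_neg_log (ha : 0 < a) (hu : u.order = ellExp j a + ellExp (j + 1) b) :
    (-log u)⁻¹.order = ellExp (j + 1) 1 := by
  rw [inv_neg_log_eq ha hu, order_single_mul (inv_ne_zero ha.ne')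
    (orderTop_heval_binomialSeries_sub_one_pos
      (orderTop_logRem_pos (ne_zero_of_order_eq ha hu)) _)]

theorem relRem_inv_neg_log_mem_supportedIn {M : AddSubmonoid Exponent} (ha : 0 < a)
    (hu : u.order = ellExp j a + ellExp (j + 1) b) (hM : relRem u ∈ supportedIn ℝ M)
    (hell : ellExp (j + 1) 1 ∈ M) (hb : b = 0 ∨ ellExp (j + 1) 1 + ellExp (j + 2) (-1) ∈ M) :
    relRem (-log u)⁻¹ ∈ supportedIn ℝ M := by
  rw [inv_neg_log_eq ha hu, relRem_single_mul (inv_ne_zero ha.ne')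
    (orderTop_heval_binomialSeries_sub_one_pos
      (orderTop_logRem_pos (ne_zero_of_order_eq ha hu)) _)]
  exact Subalgebra.sub_mem _ (heval_mem_supportedIn (logRem_mem_supportedIn hM hell hb) _)
    (Subalgebra.one_mem _)

end InvNegLog

/-- `h` has a positive leading coefficient and the leading monomial `x ^ a * ℓ ^ b`, `a > 0`. -/
structure HasLeading (h : Transseries) (a b : ℝ) : Prop where
  leadingCoeff_pos : 0 < h.leadingCoeff
  order_eq : h.order = expo a b 0
  pos : 0 < a

namespace HasLeading

variable {h : Transseries} {a b : ℝ}

theorem ne_zero (H : HasLeading h a b) : h ≠ 0 :=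
  ne_zero_of_leadingCoeff_pos H.leadingCoeff_pos

theorem isPosInfinitesimal (H : HasLeading h a b) : IsPosInfinitesimal h :=
  ⟨H.leadingCoeff_pos, by rw [H.order_eq, expo_zero]; exact ellExp_add_ellExp_succ_pos 0 H.pos b⟩

theorem leadingCoeff_ellComp_one (H : HasLeading h a b) : (ellComp h 1).leadingCoeff = a⁻¹ :=
  leadingCoeff_inv_neg_log H.pos (H.order_eq.trans (expo_zero a b))

theorem order_ellComp_succ (H : HasLeading h a b) (j : ℕ) :
    (ellComp h (j + 1)).order = ellExp (j + 1) 1 := by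
  induction j with
  | zero => exact order_inv_neg_log H.pos (H.order_eq.trans (expo_zero a b))
  | succ j ih => exact order_inv_neg_log (b := 0) one_pos (by rw [ih, ellExp_zero, add_zero])

theorem leadingCoeff_ellComp_succ_succ (H : HasLeading h a b) (j : ℕ) :
    (ellComp h (j + 2)).leadingCoeff = 1 := by
  rw [ellComp, leadingCoeff_inv_neg_log (b := 0) one_pos
    (by rw [H.order_ellComp_succ, ellExp_zero, add_zero]), inv_one]

theorem relRem_ellComp_one_mem (H : HasLeading h a b) {M : AddSubmonoid Exponent}
    (hM : relRem h ∈ supportedIn ℝ M) (hell : ellExp 1 1 ∈ M)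
    (hb : b = 0 ∨ ellExp 1 1 + ellExp 2 (-1) ∈ M) : relRem (ellComp h 1) ∈ supportedIn ℝ M :=
  relRem_inv_neg_log_mem_supportedIn H.pos (H.order_eq.trans (expo_zero a b)) hM hell hb

theorem relRem_ellComp_succ_succ_mem (H : HasLeading h a b) {M : AddSubmonoid Exponent} {j : ℕ}
    (hM : relRem (ellComp h (j + 1)) ∈ supportedIn ℝ M) (hell : ellExp (j + 2) 1 ∈ M) :
    relRem (ellComp h (j + 2)) ∈ supportedIn ℝ M :=
  relRem_inv_neg_log_mem_supportedIn one_pos (by rw [H.order_ellComp_succ, ellExp_zero, add_zero])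
    hM hell (Or.inl rfl)

end HasLeading

/-! ### Strongly linear substitutions -/

section TermFamily

variable {Γ K : Type*} [LinearOrder Γ] [Field K]

/-- The family of the terms of `f`. -/
def termFamily (f : HahnSeries Γ K) : SummableFamily Γ K Γ where
  toFun n := HahnSeries.single n (f.coeff n)
  isPWO_iUnion_support' := f.isPWO_support.mono (Set.iUnion_subset fun n p hp => by
    obtain rfl := eq_of_mem_support_single hp
    rwa [mem_support, coeff_single_same] at hp)
  finite_co_support' p := (Set.finite_singleton p).subset fun n hn =>
    (eq_of_mem_support_single (mem_support _ _ |>.2 hn)).symm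

theorem termFamily_apply (f : HahnSeries Γ K) (n : Γ) :
    termFamily f n = HahnSeries.single n (f.coeff n) := rfl

theorem hsum_termFamily (f : HahnSeries Γ K) : (termFamily f).hsum = f := by
  ext p
  rw [coeff_hsum, finsum_eq_single _ p fun n hn => by
    rw [termFamily_apply, coeff_single_of_ne hn.symm], termFamily_apply, coeff_single_same]

end TermFamily

section LeadingTerm

variable {Γ K : Type*} [AddCommGroup Γ] [LinearOrder Γ] [Field K] {f : HahnSeries Γ K}
  {m : Γ → HahnSeries Γ K} {s : SummableFamily Γ K Γ}

theorem coeff_hsum_order_of_strictMono (hs : ∀ n, s n = f.coeff n • m n)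
    (hm : StrictMono fun n => (m n).order) :
    s.hsum.coeff (m f.order).order = f.leadingCoeff * (m f.order).leadingCoeff := by
  rw [coeff_hsum, finsum_eq_single _ f.order fun n hn => ?_, hs, HahnSeries.coeff_smul,
    leadingCoeff_eq, leadingCoeff_eq, smul_eq_mul]
  rw [hs, HahnSeries.coeff_smul, smul_eq_mul, mul_eq_zero]
  exact or_iff_not_imp_left.2 fun h =>
    coeff_eq_zero_of_lt_order (hm ((order_le_of_coeff_ne_zero h).lt_of_ne hn.symm))

theorem order_hsum_of_strictMono (hs : ∀ n, s n = f.coeff n • m n)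
    (hm : StrictMono fun n => (m n).order) (hf : f ≠ 0) (hm0 : m f.order ≠ 0) :
    s.hsum.order = (m f.order).order := by
  have hcoeff : s.hsum.coeff (m f.order).order ≠ 0 := by
    rw [coeff_hsum_order_of_strictMono hs hm]
    exact mul_ne_zero (leadingCoeff_ne_zero.2 hf) (leadingCoeff_ne_zero.2 hm0)
  have hsum0 : s.hsum ≠ 0 := ne_zero_of_coeff_ne_zero hcoeff
  refine le_antisymm (order_le_of_coeff_ne_zero hcoeff) ?_
  obtain ⟨n, hn⟩ := Set.mem_iUnion.1
    (support_hsum_subset (mem_support _ _ |>.2 (coeff_order_eq_zero.not.2 hsum0)))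
  rw [mem_support, hs, HahnSeries.coeff_smul, smul_eq_mul] at hn
  exact (hm.monotone (order_le_of_coeff_ne_zero (left_ne_zero_of_mul hn))).trans
    (order_le_of_coeff_ne_zero (right_ne_zero_of_mul hn))

theorem leadingCoeff_hsum_of_strictMono (hs : ∀ n, s n = f.coeff n • m n)
    (hm : StrictMono fun n => (m n).order) (hf : f ≠ 0) (hm0 : m f.order ≠ 0) :
    s.hsum.leadingCoeff = f.leadingCoeff * (m f.order).leadingCoeff := by
  rw [leadingCoeff_eq, order_hsum_of_strictMono hs hm hf hm0, coeff_hsum_order_of_strictMono hs hm]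

end LeadingTerm

theorem exists_finsum_mul_eq_of_triangular {α K : Type*} [PartialOrder α] [WellFoundedLT α]
    [Field K] {A : α → α → K} (hfin : ∀ p, {q | A q p ≠ 0}.Finite)
    (hle : ∀ q p, A q p ≠ 0 → q ≤ p) (hdiag : ∀ p, A p p ≠ 0) (d : α → K) :
    ∃ b : α → K, ∀ p, ∑ᶠ q, b q * A q p = d p := by
  classical
  let step (p : α) (b : (q : α) → q < p → K) : K :=
    (d p - ∑ q ∈ (hfin p).toFinset.erase p, if h : q < p then b q h * A q p else 0) / A p p
  let b : α → K := wellFounded_lt.fix step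
  have hrec (p : α) :
      b p * A p p = d p - ∑ q ∈ (hfin p).toFinset.erase p, b q * A q p := by
    have hfix : b p = step p fun q _ => b q := wellFounded_lt.fix_eq step p
    rw [hfix, div_mul_cancel₀ _ (hdiag p)]
    congr 1
    refine Finset.sum_congr rfl fun q hq => dif_pos ?_
    obtain ⟨hqp, hq⟩ := Finset.mem_erase.1 hq
    exact (hle q p ((Set.Finite.mem_toFinset _).1 hq)).lt_of_ne hqp
  refine ⟨b, fun p => ?_⟩
  rw [finsum_eq_sum_of_support_subset (s := (hfin p).toFinset) _ fun q hq =>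
      Finset.mem_coe.2 ((Set.Finite.mem_toFinset _).2 (right_ne_zero_of_mul hq)),
    ← Finset.add_sum_erase _ _ ((Set.Finite.mem_toFinset _).2 (hdiag p)), hrec p, sub_add_cancel]

/-- A multiplicative assignment `M ↦ M ∘ h` of series to monomials which extends to a strongly
linear endomorphism of the field of series: the leading exponents increase strictly, and all the
supports, each relative to its leading exponent, lie in one partially well-ordered set. -/
structure MonomialSubst (Γ K : Type*) [AddCommGroup Γ] [LinearOrder Γ] [IsOrderedAddMonoid Γ]
    [Field K] where
  /-- The image of a monomial. -/
  toFun : Γ → HahnSeries Γ K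
  map_zero : toFun 0 = 1
  map_add : ∀ n k, toFun (n + k) = toFun n * toFun k
  strictMono_order : StrictMono fun n => (toFun n).order
  isPWO_relSupport : {t | ∃ n, (toFun n).order + t ∈ (toFun n).support}.IsPWO

namespace MonomialSubst

variable {Γ K : Type*} [AddCommGroup Γ] [LinearOrder Γ] [IsOrderedAddMonoid Γ] [Field K]
  (S : MonomialSubst Γ K)

theorem toFun_ne_zero (n : Γ) : S.toFun n ≠ 0 := by
  refine left_ne_zero_of_mul (b := S.toFun (-n)) ?_
  rw [← S.map_add, add_neg_cancel, S.map_zero]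
  exact one_ne_zero

theorem finite_setOf_coeff_ne_zero {W : Set Γ} (hW : W.IsPWO) (p : Γ) :
    {n ∈ W | (S.toFun n).coeff p ≠ 0}.Finite := by
  have h := Set.AddAntidiagonal.finite_of_isPWO
    (hW.image_of_monotone S.strictMono_order.monotone) S.isPWO_relSupport p
  refine Set.Finite.of_finite_image ((h.image Prod.fst).subset ?_)
    S.strictMono_order.injective.injOn
  rintro _ ⟨n, ⟨hn, hp⟩, rfl⟩
  exact ⟨((S.toFun n).order, p - (S.toFun n).order),
    ⟨⟨n, hn, rfl⟩, ⟨n, by rwa [add_sub_cancel]⟩, add_sub_cancel _ _⟩, rfl⟩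

theorem isPWO_biUnion_support {W : Set Γ} (hW : W.IsPWO) :
    (⋃ n ∈ W, (S.toFun n).support).IsPWO := by
  refine ((hW.image_of_monotone S.strictMono_order.monotone).add S.isPWO_relSupport).mono ?_
  refine Set.iUnion₂_subset fun n hn p hp => ?_
  exact ⟨_, ⟨n, hn, rfl⟩, p - (S.toFun n).order, ⟨n, by rwa [add_sub_cancel]⟩,
    add_sub_cancel _ _⟩

/-- The family of the images of the terms of `f`. -/
def family (f : HahnSeries Γ K) : SummableFamily Γ K Γ where
  toFun n := f.coeff n • S.toFun n
  isPWO_iUnion_support' := (S.isPWO_biUnion_support f.isPWO_support).mono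
    (Set.iUnion_subset fun _ p hp => by
      rw [HahnSeries.mem_support, HahnSeries.coeff_smul, smul_eq_mul] at hp
      exact Set.mem_biUnion (left_ne_zero_of_mul hp) (right_ne_zero_of_mul hp))
  finite_co_support' p := (S.finite_setOf_coeff_ne_zero f.isPWO_support p).subset fun n hn => by
    rw [Set.mem_ofPred_eq, HahnSeries.coeff_smul, smul_eq_mul] at hn
    exact ⟨left_ne_zero_of_mul hn, right_ne_zero_of_mul hn⟩

theorem family_apply (f : HahnSeries Γ K) (n : Γ) : S.family f n = f.coeff n • S.toFun n := rfl

/-- The strongly linear extension `f ↦ f ∘ h` of `M ↦ M ∘ h`. -/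
def subst (f : HahnSeries Γ K) : HahnSeries Γ K := (S.family f).hsum

theorem coeff_subst (f : HahnSeries Γ K) (p : Γ) :
    (S.subst f).coeff p = ∑ᶠ n, f.coeff n * (S.toFun n).coeff p := by
  rw [subst, coeff_hsum]; rfl

theorem coeff_subst_eq_sum {f : HahnSeries Γ K} {p : Γ} {N : Finset Γ}
    (hN : ∀ n ∈ f.support, (S.toFun n).coeff p ≠ 0 → n ∈ N) :
    (S.subst f).coeff p = ∑ n ∈ N, f.coeff n * (S.toFun n).coeff p := by
  rw [coeff_subst]
  exact finsum_eq_sum_of_support_subset _ fun n hn =>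
    hN n (left_ne_zero_of_mul hn) (right_ne_zero_of_mul hn)

theorem support_subst_subset (f : HahnSeries Γ K) :
    (S.subst f).support ⊆ ⋃ n ∈ f.support, (S.toFun n).support := by
  intro p hp
  obtain ⟨n, hn⟩ := Set.mem_iUnion.1 (support_hsum_subset hp)
  rw [HahnSeries.mem_support, family_apply, HahnSeries.coeff_smul, smul_eq_mul] at hn
  exact Set.mem_biUnion (left_ne_zero_of_mul hn) (right_ne_zero_of_mul hn)

theorem order_subst {f : HahnSeries Γ K} (hf : f ≠ 0) :
    (S.subst f).order = (S.toFun f.order).order :=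
  order_hsum_of_strictMono (S.family_apply f) S.strictMono_order hf (S.toFun_ne_zero _)

theorem leadingCoeff_subst {f : HahnSeries Γ K} (hf : f ≠ 0) :
    (S.subst f).leadingCoeff = f.leadingCoeff * (S.toFun f.order).leadingCoeff :=
  leadingCoeff_hsum_of_strictMono (S.family_apply f) S.strictMono_order hf (S.toFun_ne_zero _)

theorem subst_single (n : Γ) (c : K) : S.subst (HahnSeries.single n c) = c • S.toFun n := by
  ext p
  rw [coeff_subst, finsum_eq_single _ n fun k hk => by
    rw [coeff_single_of_ne hk, zero_mul], coeff_single_same, HahnSeries.coeff_smul, smul_eq_mul]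

theorem subst_zero : S.subst 0 = 0 := by
  ext p
  simp only [coeff_subst, HahnSeries.coeff_zero, zero_mul, finsum_zero]

theorem subst_one : S.subst 1 = 1 := by
  rw [← single_zero_one, subst_single, map_zero, one_smul, single_zero_one]

theorem subst_add (f g : HahnSeries Γ K) : S.subst (f + g) = S.subst f + S.subst g := by
  rw [subst, subst, subst, ← hsum_add]
  congr 1
  ext n p
  rw [SummableFamily.add_apply, HahnSeries.coeff_add, family_apply, family_apply, family_apply,
    HahnSeries.coeff_smul, HahnSeries.coeff_smul, HahnSeries.coeff_smul, HahnSeries.coeff_add,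
    add_smul]

variable {ι : Type*}

open Classical in
/-- A finite set of indices outside of which the members of `s` contribute nothing to the
coefficient at `p` of the substituted sum. -/
def contributing (s : SummableFamily Γ K ι) (p : Γ) : Finset ι :=
  (S.finite_setOf_coeff_ne_zero s.isPWO_iUnion_support p).toFinset.biUnion
    fun n => (s.coeff n).support

theorem coeff_subst_apply_eq_sum (s : SummableFamily Γ K ι) (p : Γ) (i : ι) :
    (S.subst (s i)).coeff p =
      ∑ n ∈ (S.finite_setOf_coeff_ne_zero s.isPWO_iUnion_support p).toFinset,
        (s i).coeff n * (S.toFun n).coeff p :=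
  S.coeff_subst_eq_sum fun _ hn hp =>
    (Set.Finite.mem_toFinset _).2 ⟨Set.mem_iUnion.2 ⟨i, hn⟩, hp⟩

theorem mem_contributing {s : SummableFamily Γ K ι} {p n : Γ} {i : ι}
    (hn : n ∈ (S.finite_setOf_coeff_ne_zero s.isPWO_iUnion_support p).toFinset)
    (hi : (s i).coeff n ≠ 0) : i ∈ S.contributing s p := by
  classical exact Finset.mem_biUnion.2 ⟨n, hn, Finsupp.mem_support_iff.2 hi⟩

theorem mem_contributing_of_coeff_subst_ne_zero {s : SummableFamily Γ K ι} {p : Γ} {i : ι}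
    (hi : (S.subst (s i)).coeff p ≠ 0) : i ∈ S.contributing s p := by
  rw [coeff_subst_apply_eq_sum] at hi
  obtain ⟨n, hn, h⟩ := Finset.exists_ne_zero_of_sum_ne_zero hi
  exact S.mem_contributing hn (left_ne_zero_of_mul h)

theorem coeff_subst_hsum_eq_sum (s : SummableFamily Γ K ι) (p : Γ) :
    (S.subst s.hsum).coeff p = ∑ i ∈ S.contributing s p, (S.subst (s i)).coeff p := by
  rw [S.coeff_subst_eq_sum
      (N := (S.finite_setOf_coeff_ne_zero s.isPWO_iUnion_support p).toFinset) fun n hn hp =>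
      (Set.Finite.mem_toFinset _).2 ⟨support_hsum_subset hn, hp⟩,
    Finset.sum_congr rfl fun i _ => S.coeff_subst_apply_eq_sum s p i, Finset.sum_comm]
  refine Finset.sum_congr rfl fun n hn => ?_
  rw [coeff_hsum_eq_sum_of_subset fun i hi => Finset.mem_coe.2 (S.mem_contributing hn hi),
    Finset.sum_mul]

/-- The images of the members of a summable family. -/
def mapFamily (s : SummableFamily Γ K ι) : SummableFamily Γ K ι where
  toFun i := S.subst (s i)
  isPWO_iUnion_support' := (S.isPWO_biUnion_support s.isPWO_iUnion_support).mono
    (Set.iUnion_subset fun i => (S.support_subst_subset (s i)).trans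
      (Set.biUnion_subset_biUnion_left (Set.subset_iUnion (fun i => (s i).support) i)))
  finite_co_support' p := (S.contributing s p).finite_toSet.subset fun _ =>
    S.mem_contributing_of_coeff_subst_ne_zero

theorem mapFamily_apply (s : SummableFamily Γ K ι) (i : ι) : S.mapFamily s i = S.subst (s i) := rfl

theorem subst_hsum (s : SummableFamily Γ K ι) : S.subst s.hsum = (S.mapFamily s).hsum := by
  ext p
  have hsub : {i | (S.mapFamily s i).coeff p ≠ 0} ⊆ S.contributing s p := fun _ =>
    S.mem_contributing_of_coeff_subst_ne_zero
  rw [coeff_subst_hsum_eq_sum, coeff_hsum_eq_sum_of_subset hsub]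
  rfl

theorem subst_mul (f g : HahnSeries Γ K) : S.subst (f * g) = S.subst f * S.subst g := by
  conv_lhs => rw [← hsum_termFamily f, ← hsum_termFamily g, ← hsum_mul, subst_hsum]
  rw [subst, subst, ← hsum_mul]
  congr 1
  ext1 ⟨n, k⟩
  rw [mapFamily_apply, mul_toFun, mul_toFun, termFamily_apply, termFamily_apply, single_mul_single,
    subst_single, map_add, family_apply, family_apply, smul_mul_smul_comm]

/-- Substitution as a ring endomorphism. -/
def hom : HahnSeries Γ K →+* HahnSeries Γ K where
  toFun := S.subst
  map_one' := S.subst_one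
  map_mul' := S.subst_mul
  map_zero' := S.subst_zero
  map_add' := S.subst_add

theorem hom_apply (f : HahnSeries Γ K) : S.hom f = S.subst f := rfl

theorem hom_single (n : Γ) (c : K) : S.hom (HahnSeries.single n c) = c • S.toFun n :=
  S.subst_single n c

theorem hom_C (c : K) : S.hom (HahnSeries.C c) = HahnSeries.C c := by
  rw [HahnSeries.C_apply, hom_single, S.map_zero, ← HahnSeries.C_mul_eq_smul, mul_one,
    HahnSeries.C_apply]

theorem hom_smul (c : K) (f : HahnSeries Γ K) : S.hom (c • f) = c • S.hom f := by
  rw [← HahnSeries.C_mul_eq_smul, map_mul, hom_C, HahnSeries.C_mul_eq_smul]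

theorem orderTop_hom_pos {e : HahnSeries Γ K} (he : 0 < e.orderTop) : 0 < (S.hom e).orderTop := by
  rcases eq_or_ne e 0 with rfl | he0
  · rwa [RingHom.map_zero]
  have horder : 0 < e.order := by
    rwa [← order_eq_orderTop_of_ne_zero he0, WithTop.coe_pos] at he
  rw [← order_eq_orderTop_of_ne_zero ((map_ne_zero S.hom).2 he0), hom_apply, S.order_subst he0,
    WithTop.coe_pos]
  simpa only [S.map_zero, HahnSeries.order_one] using S.strictMono_order horder

theorem hom_heval [CharZero K] {e : HahnSeries Γ K} (he : 0 < e.orderTop) (f : PowerSeries K) :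
    S.hom (heval e f) = heval (S.hom e) f := by
  rw [heval_apply, heval_apply, hom_apply, subst_hsum]
  congr 1
  ext1 i
  rw [mapFamily_apply, powerSeriesFamily_of_orderTop_pos he,
    powerSeriesFamily_of_orderTop_pos (S.orderTop_hom_pos he), ← hom_apply, hom_smul, map_pow]

theorem exists_subst_eq {W : Set Γ} (hW : W.IsPWO)
    (hclosed : ∀ n ∈ W, (S.toFun n).support ⊆ (fun n => (S.toFun n).order) '' W)
    {f : HahnSeries Γ K} (hf : f.support ⊆ (fun n => (S.toFun n).order) '' W) :
    ∃ h : HahnSeries Γ K, h.support ⊆ W ∧ S.subst h = f := by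
  have : WellFoundedLT W := ⟨hW.isWF⟩
  obtain ⟨b, hb⟩ := exists_finsum_mul_eq_of_triangular
    (A := fun q p : W => (S.toFun q).coeff (S.toFun p).order)
    (fun p => Set.Finite.of_finite_image ((S.finite_setOf_coeff_ne_zero hW _).subset
      (Set.image_subset_iff.2 fun q hq => ⟨q.2, hq⟩)) Subtype.val_injective.injOn)
    (fun q p h => S.strictMono_order.le_iff_le.1 (order_le_of_coeff_ne_zero h))
    (fun p => coeff_order_eq_zero.not.2 (S.toFun_ne_zero p))
    fun p => f.coeff (S.toFun p).order
  classical
  let c (n : Γ) : K := if h : n ∈ W then b ⟨n, h⟩ else 0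
  have hc : Function.support c ⊆ W := fun n hn => by_contra fun h => hn (dif_neg h)
  refine ⟨⟨c, hW.mono hc⟩, hc, ?_⟩
  ext p
  rw [coeff_subst]
  by_cases hp : p ∈ (fun n => (S.toFun n).order) '' W
  · obtain ⟨n, hn, rfl⟩ := hp
    rw [← hb ⟨n, hn⟩, ← Set.indicator_eq_self.2 fun k hk => hc (left_ne_zero_of_mul hk),
      ← finsum_mem_def, ← finsum_set_coe_eq_finsum_mem]
    exact finsum_congr fun q => congrArg (· * _) (dif_pos q.2)
  · rw [by_contra fun h => hp (hf h), finsum_eq_zero_of_forall_eq_zero fun n => ?_]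
    by_contra h
    exact hp (hclosed n (hc (left_ne_zero_of_mul h)) (right_ne_zero_of_mul h))

end MonomialSubst

/-! ### Composition of transseries -/

section MonomialProd

/-- The product `∏ j, U j ^ n j`, which is `M ∘ h` for the monomial `M` with exponent `n` if
`U j = ℓ_j ∘ h`. -/
def monomialProd (U : ℕ → Transseries) (n : Exponent) : Transseries :=
  (ofLex n).prod fun j r => rpow (U j) r

variable {U V : ℕ → Transseries}

theorem monomialProd_zero : monomialProd U 0 = 1 := Finsupp.prod_zero_index

theorem monomialProd_ellExp (j : ℕ) (r : ℝ) : monomialProd U (ellExp j r) = rpow (U j) r :=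
  Finsupp.prod_single_index (rpow_zero _)

theorem monomialProd_add (hU : ∀ j, 0 < (U j).leadingCoeff) (n k : Exponent) :
    monomialProd U (n + k) = monomialProd U n * monomialProd U k :=
  Finsupp.prod_add_index' (fun _ => rpow_zero _) fun j => rpow_add (hU j)

theorem monomialProd_congr {n : Exponent} (h : ∀ j, ofLex n j ≠ 0 → U j = V j) :
    monomialProd U n = monomialProd V n :=
  Finsupp.prod_congr fun j hj => by rw [h j (Finsupp.mem_support_iff.1 hj)]

theorem exponent_induction {P : Exponent → Prop} (zero : P 0)
    (add : ∀ n k, P n → P k → P (n + k)) (ellExp : ∀ j r, P (ellExp j r)) (n : Exponent) : P n :=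
  Finsupp.induction_linear (motive := fun f => P (toLex f)) (ofLex n) zero (fun _ _ => add _ _)
    ellExp

theorem leadingCoeff_monomialProd_pos (hU : ∀ j, 0 < (U j).leadingCoeff) (n : Exponent) :
    0 < (monomialProd U n).leadingCoeff :=
  Finset.prod_induction _ (fun u : Transseries => 0 < u.leadingCoeff)
    (fun _ _ => leadingCoeff_mul_pos) (by rw [leadingCoeff_one]; exact one_pos)
    fun j _ => leadingCoeff_rpow_pos (hU j) _

theorem relRem_monomialProd_mem {M : AddSubmonoid Exponent} {n : Exponent}
    (hU : ∀ j, 0 < (U j).leadingCoeff)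
    (hM : ∀ j, ofLex n j ≠ 0 → relRem (U j) ∈ supportedIn ℝ M) :
    relRem (monomialProd U n) ∈ supportedIn ℝ M := by
  refine (Finset.prod_induction _
    (fun u : Transseries => u ≠ 0 ∧ relRem u ∈ supportedIn ℝ M) ?_ ?_ fun j hj => ?_).2
  · rintro u v ⟨hu0, hu⟩ ⟨hv0, hv⟩
    refine ⟨mul_ne_zero hu0 hv0, ?_⟩
    rw [relRem_mul hu0 hv0]
    exact add_mem (add_mem hu hv) (mul_mem hu hv)
  · refine ⟨one_ne_zero, ?_⟩
    rw [← single_zero_one, relRem_single _ one_ne_zero]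
    exact zero_mem _
  · refine ⟨ne_zero_of_leadingCoeff_pos (leadingCoeff_rpow_pos (hU j) _), ?_⟩
    rw [relRem_rpow (hU j)]
    exact sub_mem (heval_mem_supportedIn (hM j (Finsupp.mem_support_iff.1 hj)) _) (one_mem _)

theorem monomialProd_smul (hU : ∀ j, 0 < (U j).leadingCoeff) (r : ℝ) (n : Exponent) :
    monomialProd U (r • n) = rpow (monomialProd U n) r := by
  induction n using exponent_induction with
  | zero => rw [smul_zero, monomialProd_zero, ← single_zero_one, rpow_single _ one_ne_zero,
      smul_zero, Real.one_rpow]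
  | add n k hn hk => rw [smul_add, monomialProd_add hU, monomialProd_add hU, hn, hk,
      rpow_mul (leadingCoeff_monomialProd_pos hU n) (leadingCoeff_monomialProd_pos hU k)]
  | ellExp j s => rw [smul_ellExp, monomialProd_ellExp, monomialProd_ellExp, rpow_rpow (hU j),
      mul_comm]

theorem log_monomialProd (hU : ∀ j, 0 < (U j).leadingCoeff) (n : Exponent) :
    log (monomialProd U n) = (ofLex n).sum fun j r => r • log (U j) := by
  induction n using exponent_induction with
  | zero => simp [monomialProd_zero, ← single_zero_one, log_single, negLogMonomial]
  | add n k hn hk => rw [monomialProd_add hU,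
      log_mul (ne_zero_of_leadingCoeff_pos (leadingCoeff_monomialProd_pos hU n))
        (ne_zero_of_leadingCoeff_pos (leadingCoeff_monomialProd_pos hU k)), hn, hk, ofLex_add,
      Finsupp.sum_add_index' (h := fun j r => r • log (U j)) (fun j => zero_smul ℝ (log (U j)))
        fun j r s => add_smul r s (log (U j))]
  | ellExp j r => rw [monomialProd_ellExp, log_rpow (hU j), ellExp, ofLex_toLex,
      Finsupp.sum_single_index (h := fun j r => r • log (U j))
        (zero_smul ℝ (log (U j)))]

theorem monomialProd_single_ellExp (n : Exponent) :
    monomialProd (fun j => HahnSeries.single (ellExp j 1) 1) n = HahnSeries.single n 1 := by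
  have hU (j : ℕ) : 0 < (HahnSeries.single (ellExp j 1) (1 : ℝ)).leadingCoeff := by
    rw [leadingCoeff_of_single]
    exact one_pos
  induction n using exponent_induction with
  | zero => rw [monomialProd_zero, single_zero_one]
  | add n k hn hk => rw [monomialProd_add hU, hn, hk, single_mul_single, one_mul]
  | ellExp j r => rw [monomialProd_ellExp, rpow_single _ one_ne_zero, smul_ellExp, mul_one,
      Real.one_rpow]

theorem ellComp_idT (j : ℕ) : ellComp idT j = HahnSeries.single (ellExp j 1) 1 := by
  induction j with
  | zero => rfl
  | succ j ih => rw [ellComp, ih, log_single _ one_ne_zero, negLogMonomial_ellExp, Real.log_one,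
      map_zero, zero_sub, neg_neg, inv_single, neg_ellExp, neg_neg, inv_one]

theorem monomialComp_eq_monomialProd (h : Transseries) :
    monomialComp h = monomialProd (ellComp h) := rfl

theorem monomialComp_idT (n : Exponent) : monomialComp idT n = HahnSeries.single n 1 := by
  rw [monomialComp_eq_monomialProd, funext ellComp_idT, monomialProd_single_ellExp]

end MonomialProd

section LeadExp

/-- The exponent of the leading monomial of `M ∘ h`, where `M` has the exponent `n` and `h` has the
leading monomial `x ^ a * ℓ ^ b`. -/
def leadExp (a b : ℝ) (n : Exponent) : Exponent :=
  n + expo ((a - 1) * ofLex n 0) (b * ofLex n 0) 0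

theorem ofLex_leadExp_zero (a b : ℝ) (n : Exponent) :
    ofLex (leadExp a b n) 0 = a * ofLex n 0 := by
  rw [leadExp, ofLex_add_apply, ofLex_expo_apply]
  simp
  ring

theorem ofLex_leadExp_one (a b : ℝ) (n : Exponent) :
    ofLex (leadExp a b n) 1 = b * ofLex n 0 + ofLex n 1 := by
  rw [leadExp, ofLex_add_apply, ofLex_expo_apply]
  simp
  ring

theorem ofLex_leadExp_add_two (a b : ℝ) (n : Exponent) (j : ℕ) :
    ofLex (leadExp a b n) (j + 2) = ofLex n (j + 2) := by
  rw [leadExp, ofLex_add_apply, ofLex_expo_apply]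
  simp

theorem exponent_ext_cases {n k : Exponent} (h0 : ofLex n 0 = ofLex k 0)
    (h1 : ofLex n 1 = ofLex k 1) (h2 : ∀ j, ofLex n (j + 2) = ofLex k (j + 2)) : n = k :=
  exponent_ext fun
    | 0 => h0
    | 1 => h1
    | j + 2 => h2 j

theorem leadExp_add (a b : ℝ) (n k : Exponent) :
    leadExp a b (n + k) = leadExp a b n + leadExp a b k := by
  apply exponent_ext_cases <;>
    simp [ofLex_leadExp_zero, ofLex_leadExp_one, ofLex_leadExp_add_two] <;> ring

theorem leadExp_zero (a b : ℝ) : leadExp a b 0 = 0 :=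
  add_eq_left (a := leadExp a b 0).1 (by rw [← leadExp_add, add_zero])

theorem leadExp_ellExp_zero (a b : ℝ) : leadExp a b (ellExp 0 1) = expo a b 0 := by
  apply exponent_ext_cases <;>
    simp [ofLex_leadExp_zero, ofLex_leadExp_one, ofLex_leadExp_add_two, ofLex_ellExp_apply,
      ofLex_expo_apply]

theorem leadExp_leadExp {a : ℝ} (ha : a ≠ 0) (b : ℝ) (n : Exponent) :
    leadExp a b (leadExp a⁻¹ (-b / a) n) = n := by
  refine exponent_ext_cases ?_ ?_ fun j => ?_
  · rw [ofLex_leadExp_zero, ofLex_leadExp_zero, mul_inv_cancel_left₀ ha]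
  · rw [ofLex_leadExp_one, ofLex_leadExp_zero, ofLex_leadExp_one]
    ring
  · rw [ofLex_leadExp_add_two, ofLex_leadExp_add_two]

theorem strictMono_leadExp {a : ℝ} (ha : 0 < a) (b : ℝ) : StrictMono (leadExp a b) := by
  intro n k hnk
  obtain ⟨i, hi, hlt⟩ := Finsupp.Lex.lt_iff.1 hnk
  refine Finsupp.Lex.lt_iff.2 ⟨i, fun j hj => ?_, ?_⟩
  · match j with
    | 0 => rw [ofLex_leadExp_zero, ofLex_leadExp_zero, hi 0 hj]
    | 1 => rw [ofLex_leadExp_one, ofLex_leadExp_one, hi 0 (by omega), hi 1 hj]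
    | j + 2 => rw [ofLex_leadExp_add_two, ofLex_leadExp_add_two, hi _ hj]
  · match i with
    | 0 =>
      rw [ofLex_leadExp_zero, ofLex_leadExp_zero]
      exact mul_lt_mul_of_pos_left hlt ha
    | 1 =>
      rw [ofLex_leadExp_one, ofLex_leadExp_one, hi 0 one_pos]
      exact (add_lt_add_iff_left _).2 hlt
    | i + 2 => rwa [ofLex_leadExp_add_two, ofLex_leadExp_add_two]

end LeadExp

/-- The leading terms of the `U j` are those of the `ℓ_j ∘ h` for a series `h` with the leading
term `c * x ^ a * ℓ ^ b`. -/
structure IsLeadingSeq (U : ℕ → Transseries) (c a b : ℝ) : Prop where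
  coeff_pos : 0 < c
  exponent_pos : 0 < a
  order_zero : (U 0).order = expo a b 0
  order_succ : ∀ j, (U (j + 1)).order = ellExp (j + 1) 1
  leadingCoeff_zero : (U 0).leadingCoeff = c
  leadingCoeff_one : (U 1).leadingCoeff = a⁻¹
  leadingCoeff_add_two : ∀ j, (U (j + 2)).leadingCoeff = 1

namespace IsLeadingSeq

variable {U : ℕ → Transseries} {c a b : ℝ}

theorem leadingCoeff_pos (hU : IsLeadingSeq U c a b) : ∀ j, 0 < (U j).leadingCoeff
  | 0 => hU.leadingCoeff_zero ▸ hU.coeff_pos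
  | 1 => hU.leadingCoeff_one ▸ inv_pos.2 hU.exponent_pos
  | j + 2 => hU.leadingCoeff_add_two j ▸ one_pos

theorem monomialProd_ne_zero (hU : IsLeadingSeq U c a b) (n : Exponent) : monomialProd U n ≠ 0 :=
  ne_zero_of_leadingCoeff_pos (leadingCoeff_monomialProd_pos hU.leadingCoeff_pos n)

theorem smul_order (hU : IsLeadingSeq U c a b) (j : ℕ) (r : ℝ) :
    r • (U j).order = leadExp a b (ellExp j r) := by
  match j with
  | 0 =>
    rw [hU.order_zero]
    apply exponent_ext_cases <;> simp [ofLex_expo_apply, ofLex_leadExp_zero, ofLex_leadExp_one,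
      ofLex_leadExp_add_two, ofLex_ellExp_apply, mul_comm]
  | j + 1 =>
    have h0 : ofLex (ellExp (j + 1) r) 0 = 0 := by
      rw [ofLex_ellExp_apply, if_neg (Nat.succ_ne_zero j)]
    rw [hU.order_succ, smul_ellExp, mul_one, leadExp, h0, mul_zero, mul_zero, expo_zero,
      ellExp_zero, ellExp_zero, add_zero, add_zero]

theorem order_monomialProd (hU : IsLeadingSeq U c a b) (n : Exponent) :
    (monomialProd U n).order = leadExp a b n := by
  induction n using exponent_induction with
  | zero => rw [monomialProd_zero, leadExp_zero, HahnSeries.order_one]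
  | add n k hn hk => rw [monomialProd_add hU.leadingCoeff_pos,
      order_mul (hU.monomialProd_ne_zero n) (hU.monomialProd_ne_zero k), hn, hk, leadExp_add]
  | ellExp j r => rw [monomialProd_ellExp, order_rpow (hU.leadingCoeff_pos j), hU.smul_order]

theorem leadingCoeff_monomialProd (hU : IsLeadingSeq U c a b) (n : Exponent) :
    (monomialProd U n).leadingCoeff = c ^ ofLex n 0 * a⁻¹ ^ ofLex n 1 := by
  induction n using exponent_induction with
  | zero => rw [monomialProd_zero, HahnSeries.leadingCoeff_one, ofLex_zero_apply, ofLex_zero_apply,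
      Real.rpow_zero, Real.rpow_zero, mul_one]
  | add n k hn hk =>
    rw [monomialProd_add hU.leadingCoeff_pos, leadingCoeff_mul, hn, hk, ofLex_add_apply,
      ofLex_add_apply, Real.rpow_add hU.coeff_pos, Real.rpow_add (inv_pos.2 hU.exponent_pos)]
    ring
  | ellExp j r =>
    have hj := ne_zero_of_leadingCoeff_pos (hU.leadingCoeff_pos j)
    rw [monomialProd_ellExp, leadingCoeff_rpow hj, ofLex_ellExp_apply, ofLex_ellExp_apply]
    match j with
    | 0 => simp [hU.leadingCoeff_zero]
    | 1 => simp [hU.leadingCoeff_one]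
    | j + 2 => simp [hU.leadingCoeff_add_two]

theorem strictMono_order (hU : IsLeadingSeq U c a b) :
    StrictMono fun n => (monomialProd U n).order := by
  rw [funext hU.order_monomialProd]
  exact strictMono_leadExp hU.exponent_pos b

end IsLeadingSeq

section Composition

variable {h k u : Transseries} {a b : ℝ}

/-- The series `ℓ_j ∘ h` for `j < 3`, and `ℓ_j` itself for the deeper `j`. -/
def truncIter (h : Transseries) (j : ℕ) : Transseries :=
  if j < 3 then ellComp h j else HahnSeries.single (ellExp j 1) 1

theorem truncIter_of_lt {j : ℕ} (hj : j < 3) : truncIter h j = ellComp h j := if_pos hj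

theorem truncIter_of_le {j : ℕ} (hj : 3 ≤ j) :
    truncIter h j = HahnSeries.single (ellExp j 1) 1 := if_neg hj.not_gt

theorem order_add_mem_support_iff (hu : u ≠ 0) {t : Exponent} (ht : t ≠ 0) :
    u.order + t ∈ u.support ↔ t ∈ (relRem u).support := by
  rw [HahnSeries.mem_support, HahnSeries.mem_support, relRem, HahnSeries.coeff_sub,
    HahnSeries.coeff_one, if_neg ht, sub_zero, coeff_single_mul, sub_neg_eq_add, add_comm t,
    mul_ne_zero_iff_left (inv_ne_zero (leadingCoeff_ne_zero.2 hu))]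

theorem mem_of_order_add_mem_support {M : AddSubmonoid Exponent} (hu : u ≠ 0)
    (hM : relRem u ∈ supportedIn ℝ M) {t : Exponent} (ht : u.order + t ∈ u.support) : t ∈ M := by
  rcases eq_or_ne t 0 with rfl | ht0
  · exact zero_mem M
  · exact hM ((order_add_mem_support_iff hu ht0).1 ht)

theorem pos_of_mem_support_relRem (hu : u ≠ 0) {t : Exponent} (ht : t ∈ (relRem u).support) :
    0 < t :=
  orderTop_pos_iff.1 (orderTop_relRem_pos hu) t ht

theorem order_add_mem_support (hu : u ≠ 0) {t : Exponent} (ht : t ∈ (relRem u).support) :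
    u.order + t ∈ u.support :=
  (order_add_mem_support_iff hu (pos_of_mem_support_relRem hu ht).ne').2 ht

namespace HasLeading

theorem isLeadingSeq_ellComp (H : HasLeading h a b) :
    IsLeadingSeq (ellComp h) h.leadingCoeff a b where
  coeff_pos := H.leadingCoeff_pos
  exponent_pos := H.pos
  order_zero := H.order_eq
  order_succ := H.order_ellComp_succ
  leadingCoeff_zero := rfl
  leadingCoeff_one := H.leadingCoeff_ellComp_one
  leadingCoeff_add_two := H.leadingCoeff_ellComp_succ_succ

theorem isLeadingSeq_truncIter (H : HasLeading h a b) :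
    IsLeadingSeq (truncIter h) h.leadingCoeff a b where
  coeff_pos := H.leadingCoeff_pos
  exponent_pos := H.pos
  order_zero := H.order_eq
  order_succ j := by
    rcases lt_or_ge (j + 1) 3 with hj | hj
    · rw [truncIter_of_lt hj, H.order_ellComp_succ]
    · rw [truncIter_of_le hj, order_single one_ne_zero]
  leadingCoeff_zero := rfl
  leadingCoeff_one := H.leadingCoeff_ellComp_one
  leadingCoeff_add_two j := by
    rcases lt_or_ge (j + 2) 3 with hj | hj
    · rw [truncIter_of_lt hj, H.leadingCoeff_ellComp_succ_succ]
    · rw [truncIter_of_le hj, leadingCoeff_of_single]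

theorem isPWO_relSupport_monomialProd_truncIter (H : HasLeading h a b) :
    {t | ∃ n, (monomialProd (truncIter h) n).order + t ∈
      (monomialProd (truncIter h) n).support}.IsPWO := by
  have hU := H.isLeadingSeq_truncIter
  set G : Set Exponent := ⋃ j ∈ Finset.range 3, (relRem (truncIter h j)).support
  have hnonneg : ∀ t ∈ G, 0 ≤ t := Set.iUnion₂_subset fun j _ t ht =>
    (pos_of_mem_support_relRem
      (ne_zero_of_leadingCoeff_pos (hU.leadingCoeff_pos j)) ht).le
  have hrel (j : ℕ) : relRem (truncIter h j) ∈ supportedIn ℝ (AddSubmonoid.closure G) := by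
    rcases lt_or_ge j 3 with hj | hj
    · exact fun t ht => AddSubmonoid.subset_closure
        (Set.mem_biUnion (Finset.mem_coe.2 (Finset.mem_range.2 hj)) ht)
    · rw [truncIter_of_le hj, relRem_single _ one_ne_zero]
      exact zero_mem _
  refine (Set.IsPWO.addSubmonoid_closure hnonneg
    ((Finset.range 3).isPWO_bUnion.2 fun j _ => isPWO_support _)).mono ?_
  rintro t ⟨n, ht⟩
  exact mem_of_order_add_mem_support (hU.monomialProd_ne_zero n)
    (relRem_monomialProd_mem hU.leadingCoeff_pos fun j _ => hrel j) ht

/-- Composition with `h`, as far as `x`, `ℓ` and `ℓ₂` are concerned. The deeper `ℓ_j` are left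
alone, because the supports of all the `ℓ_j ∘ h` together are not well ordered. -/
def compSubst (H : HasLeading h a b) : MonomialSubst Exponent ℝ where
  toFun := monomialProd (truncIter h)
  map_zero := monomialProd_zero
  map_add := monomialProd_add H.isLeadingSeq_truncIter.leadingCoeff_pos
  strictMono_order := H.isLeadingSeq_truncIter.strictMono_order
  isPWO_relSupport := H.isPWO_relSupport_monomialProd_truncIter

theorem compSubst_toFun (H : HasLeading h a b) :
    H.compSubst.toFun = monomialProd (truncIter h) := rfl

theorem monomialProd_truncIter {n : Exponent} (hn : ∀ j, 2 < j → ofLex n j = 0) :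
    monomialProd (truncIter h) n = monomialComp h n :=
  monomialProd_congr fun j hj => truncIter_of_lt (by
    by_contra hj3
    exact hj (hn j (by omega)))

theorem isComp_hom (H : HasLeading h a b) {f : Transseries}
    (hf : ∀ n ∈ f.support, ∀ j, 2 < j → ofLex n j = 0) :
    IsComp f h (H.compSubst.hom f) := by
  refine ⟨H.isPosInfinitesimal, H.compSubst.family f, fun n => ?_, rfl⟩
  rw [MonomialSubst.family_apply, compSubst_toFun]
  by_cases hn : f.coeff n = 0
  · rw [hn, ← HahnSeries.C_mul_eq_smul, ← HahnSeries.C_mul_eq_smul, map_zero, zero_mul, zero_mul]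
  · rw [monomialProd_truncIter (hf n hn)]

theorem hom_eq_mul_single_mul (H : HasLeading h a b) (hu : u ≠ 0) : H.compSubst.hom u =
    monomialProd (truncIter h) u.order *
      (HahnSeries.single 0 u.leadingCoeff * (1 + H.compSubst.hom (relRem u))) := by
  conv_lhs => rw [eq_single_mul_one_add_relRem hu]
  rw [map_mul, map_add, map_one, MonomialSubst.hom_single, compSubst_toFun,
    ← HahnSeries.C_mul_eq_smul, HahnSeries.C_apply]
  ring

theorem hom_rpow (H : HasLeading h a b) (hu : 0 < u.leadingCoeff) (r : ℝ) :
    H.compSubst.hom (rpow u r) = rpow (H.compSubst.hom u) r := by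
  have hu0 := ne_zero_of_leadingCoeff_pos hu
  have he := H.compSubst.orderTop_hom_pos (orderTop_relRem_pos hu0)
  have hU := H.isLeadingSeq_truncIter.leadingCoeff_pos
  rw [H.hom_eq_mul_single_mul hu0, rpow_mul (leadingCoeff_monomialProd_pos hU _)
    (by rwa [leadingCoeff_single_mul he]), rpow_single_mul hu.ne' he, ← monomialProd_smul hU,
    smul_zero, rpow_eq_single_smul_mul, map_mul, MonomialSubst.hom_single, compSubst_toFun,
    MonomialSubst.hom_heval _ (orderTop_relRem_pos hu0), ← HahnSeries.C_mul_eq_smul,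
    HahnSeries.C_apply]
  ring

theorem hom_negLogMonomial (H : HasLeading h a b) {n : Exponent}
    (hn : ∀ j, 1 < j → ofLex n j = 0) :
    H.compSubst.hom (negLogMonomial n) = -log (monomialProd (truncIter h) n) := by
  have hU := H.isLeadingSeq_truncIter.leadingCoeff_pos
  rw [log_monomialProd hU, negLogMonomial, map_finsuppSum, Finsupp.sum, Finsupp.sum,
    ← Finset.sum_neg_distrib]
  refine Finset.sum_congr rfl fun j hj => ?_
  have hj1 : j ≤ 1 := not_lt.1 fun hj1 => Finsupp.mem_support_iff.1 hj (hn j hj1)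
  rw [MonomialSubst.hom_single, compSubst_toFun, monomialProd_ellExp, rpow_neg_one (hU _),
    truncIter_of_lt (by omega), truncIter_of_lt (by omega), ellComp, inv_inv, smul_neg]

theorem hom_log (H : HasLeading h a b) (hu : 0 < u.leadingCoeff)
    (hn : ∀ j, 1 < j → ofLex u.order j = 0) :
    H.compSubst.hom (log u) = log (H.compSubst.hom u) := by
  have hu0 := ne_zero_of_leadingCoeff_pos hu
  have he := H.compSubst.orderTop_hom_pos (orderTop_relRem_pos hu0)
  have hv : HahnSeries.single 0 u.leadingCoeff * (1 + H.compSubst.hom (relRem u)) ≠ 0 :=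
    ne_zero_of_leadingCoeff_pos (by rwa [leadingCoeff_single_mul he])
  have hzero : negLogMonomial 0 = 0 := Finsupp.sum_zero_index
  rw [H.hom_eq_mul_single_mul hu0,
    log_mul (H.isLeadingSeq_truncIter.monomialProd_ne_zero _) hv, log_single_mul hu.ne' he, hzero,
    log_eq, map_add, map_sub, MonomialSubst.hom_C, H.hom_negLogMonomial hn,
    MonomialSubst.hom_heval _ (orderTop_relRem_pos hu0)]
  ring

theorem hom_ellComp (H : HasLeading h a b) {c d : ℝ} (K : HasLeading k c d) {j : ℕ}
    (hj : j ≤ 1) : H.compSubst.hom (ellComp k j) = ellComp (H.compSubst.hom k) j := by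
  match j, hj with
  | 0, _ => rfl
  | 1, _ =>
    have hk (i : ℕ) (hi : 1 < i) : ofLex k.order i = 0 := by
      rw [K.order_eq, ofLex_expo_apply, if_neg (by omega), if_neg (by omega), ite_self, add_zero,
        add_zero]
    rw [ellComp, ellComp, ellComp, ellComp, map_inv₀, map_neg, H.hom_log K.leadingCoeff_pos hk]

theorem hom_monomialComp (H : HasLeading h a b) {c d : ℝ} (K : HasLeading k c d) {n : Exponent}
    (hn : ∀ j, 1 < j → ofLex n j = 0) :
    H.compSubst.hom (monomialComp k n) = monomialComp (H.compSubst.hom k) n := by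
  rw [monomialComp, monomialComp, map_finsuppProd]
  refine Finsupp.prod_congr fun j hj => ?_
  have hj1 : j ≤ 1 := not_lt.1 fun hj1 => Finsupp.mem_support_iff.1 hj (hn j hj1)
  rw [H.hom_rpow (K.isLeadingSeq_ellComp.leadingCoeff_pos j), H.hom_ellComp K hj1]

theorem hom_idT (H : HasLeading h a b) : H.compSubst.hom idT = h := by
  rw [idT, MonomialSubst.hom_single, one_smul, compSubst_toFun, monomialProd_ellExp,
    truncIter_of_lt three_pos, ellComp, rpow_one H.ne_zero]

end HasLeading

variable {g : Transseries} {α m : ℝ}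

theorem hom_hom_of_hom_eq_idT (G : HasLeading g α m) (H : HasLeading h a b)
    (hg : ∀ n ∈ g.support, ∀ j, 1 < j → ofLex n j = 0) (hinv : G.compSubst.hom h = idT) :
    G.compSubst.hom (H.compSubst.hom g) = g := by
  conv_rhs => rw [← hsum_termFamily g]
  rw [MonomialSubst.hom_apply H.compSubst, MonomialSubst.subst, MonomialSubst.hom_apply,
    MonomialSubst.subst_hsum]
  congr 1
  ext1 n
  rw [MonomialSubst.mapFamily_apply, MonomialSubst.family_apply, H.compSubst_toFun,
    ← MonomialSubst.hom_apply, MonomialSubst.hom_smul, termFamily_apply]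
  by_cases hn : g.coeff n = 0
  · rw [hn, single_eq_zero, ← HahnSeries.C_mul_eq_smul, map_zero, zero_mul]
  · rw [HasLeading.monomialProd_truncIter fun j hj => hg n hn j (by omega),
      G.hom_monomialComp H (hg n hn), hinv, monomialComp_idT, ← HahnSeries.C_mul_eq_smul,
      HahnSeries.C_apply, single_mul_single, zero_add, mul_one]

theorem isFormalInverse_of_hom_eq_idT (G : HasLeading g α m) (H : HasLeading h a b)
    (hg : ∀ n ∈ g.support, ∀ j, 1 < j → ofLex n j = 0)
    (hh : ∀ n ∈ h.support, ∀ j, 2 < j → ofLex n j = 0) (hinv : G.compSubst.hom h = idT) :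
    IsFormalInverse g h := by
  have hright : H.compSubst.hom g = idT := G.compSubst.hom.injective <| by
    rw [hom_hom_of_hom_eq_idT G H hg hinv, G.hom_idT]
  have hgh := H.isComp_hom fun n hn j (hj : 2 < j) => hg n hn j (by omega)
  have hhg := G.isComp_hom hh
  rw [hright] at hgh
  rw [hinv] at hhg
  exact ⟨hgh, hhg⟩

end Composition

/-! ### Formal inverses -/

section Inverse

variable {f f' g h k : Transseries} {a b : ℝ}

theorem IsComp.left_unique (G : HasLeading g a b) (hf : IsComp f g k) (hf' : IsComp f' g k) :
    f = f' := by
  obtain ⟨-, s, hs, hsum⟩ := hf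
  obtain ⟨-, s', hs', hsum'⟩ := hf'
  by_contra hne
  have hsub (n : Exponent) : (s - s') n = (f - f').coeff n • monomialComp g n := by
    rw [SummableFamily.sub_apply, hs, hs', HahnSeries.coeff_sub]
    exact (sub_smul (f.coeff n) (f'.coeff n) (monomialComp g n)).symm
  have hcoeff := coeff_hsum_order_of_strictMono hsub G.isLeadingSeq_ellComp.strictMono_order
  rw [hsum_sub, hsum, hsum', sub_self, HahnSeries.coeff_zero] at hcoeff
  exact mul_ne_zero (leadingCoeff_ne_zero.2 (sub_ne_zero.2 hne))
    (leadingCoeff_ne_zero.2 (G.isLeadingSeq_ellComp.monomialProd_ne_zero _)) hcoeff.symm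

theorem IsFormalInverse.unique (G : HasLeading g a b) (hf : IsFormalInverse g f)
    (hh : IsFormalInverse g h) : f = h :=
  hf.2.left_unique G hh.2

namespace HasLeading

theorem relRem_truncIter_mem (G : HasLeading g a b) {M : AddSubmonoid Exponent}
    (hM : relRem g ∈ supportedIn ℝ M) (hell : ellExp 1 1 ∈ M)
    (hb : b = 0 ∨ ellExp 1 1 + ellExp 2 (-1) ∈ M) {j : ℕ} (hj : j = 2 → ellExp 2 1 ∈ M) :
    relRem (truncIter g j) ∈ supportedIn ℝ M := by
  have hM1 := G.relRem_ellComp_one_mem hM hell hb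
  match j with
  | 0 => exact hM
  | 1 => exact hM1
  | 2 => exact G.relRem_ellComp_succ_succ_mem hM1 (hj rfl)
  | j + 3 =>
    rw [truncIter_of_le (Nat.le_add_left 3 j), relRem_single _ one_ne_zero]
    exact zero_mem _

theorem compSubst_order_leadExp (G : HasLeading g a b) (q : Exponent) :
    (G.compSubst.toFun (leadExp a⁻¹ (-b / a) q)).order = q :=
  (G.isLeadingSeq_truncIter.order_monomialProd _).trans (leadExp_leadExp G.pos.ne' b q)

theorem exists_left_inverse (G : HasLeading g a b) {M : AddSubmonoid Exponent}
    (hPWO : (M : Set Exponent).IsPWO)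
    (hM : relRem g ∈ supportedIn ℝ M) (hell : ellExp 1 1 ∈ M)
    (hb : b = 0 ∨ ellExp 1 1 + ellExp 2 (-1) ∈ M)
    (hell2 : ∀ q ∈ M, ofLex q 2 ≠ 0 → ellExp 2 1 ∈ M) :
    ∃ h, G.compSubst.hom h = idT ∧
      ∀ n ∈ h.support, ∃ q ∈ M, n = leadExp a⁻¹ (-b / a) (ellExp 0 1 + q) := by
  set L : Exponent → Exponent := fun q => leadExp a⁻¹ (-b / a) (ellExp 0 1 + q)
  have hL : StrictMono L := fun _ _ h =>
    strictMono_leadExp (inv_pos.2 G.pos) _ (add_lt_add_right h _)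
  have horder (q : Exponent) : (G.compSubst.toFun (L q)).order = ellExp 0 1 + q :=
    G.compSubst_order_leadExp _
  have hofLex (q : Exponent) : ofLex (L q) 2 = ofLex q 2 := by
    rw [ofLex_leadExp_add_two, ofLex_add_apply, ofLex_ellExp_apply, if_neg two_ne_zero.symm,
      zero_add]
  have hclosed : ∀ n ∈ L '' M, (G.compSubst.toFun n).support ⊆
      (fun n => (G.compSubst.toFun n).order) '' (L '' M) := by
    rintro _ ⟨q, hq, rfl⟩ p hp
    refine ⟨L (q + (p - (G.compSubst.toFun (L q)).order)), ⟨_, add_mem hq ?_, rfl⟩, ?_⟩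
    · refine mem_of_order_add_mem_support (G.compSubst.toFun_ne_zero (L q))
        (relRem_monomialProd_mem G.isLeadingSeq_truncIter.leadingCoeff_pos
          fun j hj => G.relRem_truncIter_mem hM hell hb fun h2 => ?_) (by rwa [add_sub_cancel])
      subst h2
      exact hell2 q hq (by rwa [hofLex] at hj)
    · dsimp only
      rw [horder, horder, ← add_assoc, add_sub_cancel]
  have hidT : idT.support ⊆ (fun n => (G.compSubst.toFun n).order) '' (L '' M) := fun n hn => by
    rw [eq_of_mem_support_single hn]
    exact ⟨L 0, ⟨0, zero_mem M, rfl⟩, (horder 0).trans (add_zero _)⟩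
  obtain ⟨h, hsupp, hh⟩ :=
    G.compSubst.exists_subst_eq (hPWO.image_of_monotone hL.monotone) hclosed hidT
  refine ⟨h, hh, fun n hn => ?_⟩
  obtain ⟨q, hq, rfl⟩ := hsupp hn
  exact ⟨q, hq, rfl⟩

theorem ne_zero_of_hom_eq_idT (G : HasLeading g a b) (hh : G.compSubst.hom h = idT) : h ≠ 0 := by
  rintro rfl
  rw [map_zero, eq_comm, idT, single_eq_zero_iff] at hh
  exact one_ne_zero hh

theorem order_of_hom_eq_idT (G : HasLeading g a b) (hh : G.compSubst.hom h = idT) :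
    h.order = expo a⁻¹ (-b / a) 0 := by
  have horder := G.compSubst.order_subst (G.ne_zero_of_hom_eq_idT hh)
  rw [← MonomialSubst.hom_apply, hh, idT, order_single one_ne_zero,
    ← G.compSubst_order_leadExp (ellExp 0 1), leadExp_ellExp_zero] at horder
  exact (G.compSubst.strictMono_order.injective horder).symm

theorem leadingCoeff_of_hom_eq_idT (G : HasLeading g a b) (hh : G.compSubst.hom h = idT) :
    h.leadingCoeff = (g.leadingCoeff ^ a⁻¹ * a⁻¹ ^ (-b / a))⁻¹ := by
  have hlead := G.compSubst.leadingCoeff_subst (G.ne_zero_of_hom_eq_idT hh)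
  rw [← MonomialSubst.hom_apply, hh, idT, leadingCoeff_of_single, compSubst_toFun,
    G.isLeadingSeq_truncIter.leadingCoeff_monomialProd, G.order_of_hom_eq_idT hh] at hlead
  rw [eq_inv_of_mul_eq_one_left hlead.symm]
  simp [ofLex_expo_apply]

theorem of_hom_eq_idT (G : HasLeading g a b) (hh : G.compSubst.hom h = idT) :
    HasLeading h a⁻¹ (-b / a) where
  leadingCoeff_pos := by
    rw [G.leadingCoeff_of_hom_eq_idT hh]
    have := G.leadingCoeff_pos
    have := G.pos
    positivity
  order_eq := G.order_of_hom_eq_idT hh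
  pos := inv_pos.2 G.pos

end HasLeading

theorem HasLeading.exists_eq_leadExp_of_mem_support_relRem (G : HasLeading g a b)
    (hh : G.compSubst.hom h = idT) {M : AddSubmonoid Exponent}
    (hsupp : ∀ n ∈ h.support, ∃ q ∈ M, n = leadExp a⁻¹ (-b / a) (ellExp 0 1 + q))
    {n : Exponent} (hn : n ∈ (relRem h).support) :
    ∃ q ∈ M, q ≠ 0 ∧ n = leadExp a⁻¹ (-b / a) q := by
  have h0 := G.ne_zero_of_hom_eq_idT hh
  obtain ⟨q, hq, hqn⟩ := hsupp _ (order_add_mem_support h0 hn)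
  rw [leadExp_add, leadExp_ellExp_zero, G.order_of_hom_eq_idT hh, add_right_inj] at hqn
  refine ⟨q, hq, ?_, hqn⟩
  rintro rfl
  exact (pos_of_mem_support_relRem h0 hn).ne' (hqn.trans (leadExp_zero _ _))

end Inverse

/-! ### Supports in the classes `LInfty` and `LFin` -/

section Sequential

variable {S : Set ℝ}

theorem IsSequential.mono {T : Set ℝ} (hT : IsSequential T) (hST : S ⊆ T) : IsSequential S := by
  obtain ⟨u, hu, hlim, hsub⟩ := hT
  exact ⟨u, hu, hlim, hST.trans hsub⟩

theorem IsSequential.image_orderIso (hS : IsSequential S) (e : ℝ ≃o ℝ) :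
    IsSequential (e '' S) := by
  obtain ⟨u, hu, hlim, hsub⟩ := hS
  exact ⟨e ∘ u, e.strictMono.comp hu, e.tendsto_atTop.comp hlim,
    (Set.image_mono hsub).trans (Set.range_comp e u).ge⟩

theorem IsSequential.finite_inter_Iic (hS : IsSequential S) (B : ℝ) : (S ∩ Set.Iic B).Finite := by
  obtain ⟨u, -, hlim, hsub⟩ := hS
  obtain ⟨N, hN⟩ := Filter.eventually_atTop.1 (hlim.eventually_gt_atTop B)
  refine ((Set.finite_Iio N).image u).subset ?_
  rintro _ ⟨hs, hsB⟩
  obtain ⟨n, rfl⟩ := hsub hs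
  exact ⟨n, not_le.1 fun hn => (hN n hn).not_ge hsB, rfl⟩

theorem exists_strictMono_range_eq {α : Type*} [LinearOrder α] {T : Set α}
    (hfin : ∀ B, (T ∩ Set.Iic B).Finite) (hinf : T.Infinite) :
    ∃ u : ℕ → α, StrictMono u ∧ Set.range u = T := by
  have hIic (t : T) : (Set.Iic t).Finite :=
    ((hfin t).preimage Subtype.val_injective.injOn).subset fun s hs => ⟨s.2, hs⟩
  obtain ⟨t, ht⟩ := hinf.nonempty
  obtain ⟨b, hb, hmin⟩ := Set.exists_min_image (Set.Iic (⟨t, ht⟩ : T)) id (hIic _) ⟨_, le_rfl⟩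
  let _ : OrderBot T :=
    { bot := b
      bot_le := fun s => (le_total s ⟨t, ht⟩).elim (hmin s) hb.trans }
  have : NoMaxOrder T := ⟨fun s => by
    obtain ⟨r, hr, hrs⟩ := hinf.exists_notMem_finite (hfin s)
    exact ⟨⟨r, hr⟩, not_le.1 fun h => hrs ⟨hr, h⟩⟩⟩
  let _ : LocallyFiniteOrder T :=
    LocallyFiniteOrder.ofFiniteIcc fun _ s => (hIic s).subset Set.Icc_subset_Iic_self
  let _ := LinearLocallyFiniteOrder.succOrder T
  let _ := LinearLocallyFiniteOrder.predOrder T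
  let e : T ≃o ℕ := orderIsoNatOfLinearSuccPredArch
  refine ⟨fun n => e.symm n, Subtype.strictMono_coe _ |>.comp e.symm.strictMono, ?_⟩
  exact (e.symm.surjective.range_comp Subtype.val).trans Subtype.range_coe

theorem isSequential_of_finite_inter_Iic (hS : ∀ B, (S ∩ Set.Iic B).Finite) :
    IsSequential S := by
  set T : Set ℝ := S ∪ Set.range (Nat.cast : ℕ → ℝ)
  have hT (B : ℝ) : (T ∩ Set.Iic B).Finite := by
    rw [Set.union_inter_distrib_right]
    refine (hS B).union (((Set.finite_Iic ⌊B⌋₊).image (Nat.cast : ℕ → ℝ)).subset ?_)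
    rintro _ ⟨⟨n, rfl⟩, hn⟩
    exact ⟨n, Nat.le_floor hn, rfl⟩
  obtain ⟨u, hu, hrange⟩ := exists_strictMono_range_eq hT
    ((Set.infinite_range_of_injective Nat.cast_injective).mono Set.subset_union_right)
  refine ⟨u, hu, Filter.tendsto_atTop_atTop_of_monotone hu.monotone fun B => ?_,
    hrange ▸ Set.subset_union_left⟩
  obtain ⟨n, hn⟩ := exists_nat_ge B
  obtain ⟨k, hk⟩ : (n : ℝ) ∈ Set.range u := hrange ▸ Or.inr ⟨n, rfl⟩
  exact ⟨k, hk ▸ hn⟩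

theorem IsSequential.exists_pos_le (hS : IsSequential S) : ∃ d > 0, ∀ t ∈ S, 0 < t → d ≤ t := by
  obtain ⟨d, hd, hmin⟩ := Set.exists_min_image (insert 1 (S ∩ Set.Iic 1 ∩ Set.Ioi 0)) id
    (((hS.finite_inter_Iic 1).inter_of_left _).insert 1) (Set.insert_nonempty _ _)
  refine ⟨d, ?_, fun t ht h0 => ?_⟩
  · rcases hd with rfl | hd
    exacts [one_pos, hd.2]
  · rcases le_or_gt t 1 with h1 | h1
    · exact hmin t (Or.inr ⟨⟨ht, h1⟩, h0⟩)
    · exact (hmin 1 (Or.inl rfl)).trans h1.le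

open scoped Pointwise in
theorem IsSequential.closure (hS : IsSequential S) (h0 : ∀ t ∈ S, 0 ≤ t) :
    IsSequential (AddSubmonoid.closure S) := by
  obtain ⟨d, hd, hdS⟩ := hS.exists_pos_le
  refine isSequential_of_finite_inter_Iic fun B => ?_
  set F := insert 0 (S ∩ Set.Iic B)
  have hF (N : ℕ) : (N • F).Finite := by
    induction N with
    | zero => exact (zero_nsmul F).symm ▸ Set.finite_zero
    | succ N ih => exact (succ_nsmul F N).symm ▸ ih.add ((hS.finite_inter_Iic B).insert 0)
  have hmem : ∀ t ∈ AddSubmonoid.closure S, 0 ≤ t ∧ (t ≤ B → ∀ N : ℕ, t ≤ N * d → t ∈ N • F) := by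
    intro t ht
    induction ht using AddSubmonoid.closure_induction_left with
    | zero => exact ⟨le_rfl, fun _ N _ => Set.zero_mem_nsmul (Set.mem_insert _ _)⟩
    | add_left s hs t _ ih =>
      refine ⟨add_nonneg (h0 s hs) ih.1, fun hB N hN => ?_⟩
      rcases (h0 s hs).eq_or_lt with rfl | hs0
      · rw [zero_add] at hB hN ⊢
        exact ih.2 hB N hN
      have hds := hdS s hs hs0
      match N with
      | 0 => rw [Nat.cast_zero, zero_mul] at hN; linarith [ih.1]
      | N + 1 =>
        rw [Nat.cast_succ] at hN
        rw [succ_nsmul']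
        exact Set.add_mem_add (Or.inr ⟨hs, by simpa using by linarith [ih.1]⟩)
          (ih.2 (by linarith) N (by linarith))
  obtain ⟨N, hN⟩ := exists_nat_ge (B / d)
  exact (hF N).subset fun t ht =>
    (hmem t ht.1).2 ht.2 N (ht.2.trans ((div_le_iff₀ hd).1 hN))

theorem isSequential_of_isPWO (hS : S.IsPWO) {θ : ℝ} (hθ : ∀ t ∈ S, ∃ z : ℤ, t = θ + z) :
    IsSequential S := by
  refine isSequential_of_finite_inter_Iic fun B => ?_
  rcases S.eq_empty_or_nonempty with rfl | hne
  · rw [Set.empty_inter]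
    exact Set.finite_empty
  set c := hS.isWF.min hne
  refine ((Set.finite_Icc ⌈c - θ⌉ ⌊B - θ⌋).image fun z : ℤ => θ + z).subset ?_
  rintro t ⟨ht, hB⟩
  have hct : c ≤ t := hS.isWF.min_le hne ht
  obtain ⟨z, rfl⟩ := hθ t ht
  exact ⟨z, ⟨Int.ceil_le.2 (sub_le_iff_le_add'.2 hct),
    Int.le_floor.2 (le_sub_iff_add_le'.2 hB)⟩, rfl⟩

end Sequential

section Classes

variable {f : Transseries}

theorem ofLex_le_of_le {n k : Exponent} (hnk : n ≤ k) {j : ℕ}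
    (heq : ∀ i < j, ofLex n i = ofLex k i) : ofLex n j ≤ ofLex k j := by
  rcases hnk.eq_or_lt with rfl | hlt
  · exact le_rfl
  obtain ⟨i, hi, hlt⟩ := Finsupp.Lex.lt_iff.1 hlt
  rcases lt_trichotomy i j with hij | rfl | hij
  · exact absurd hlt (heq i hij).not_lt
  · exact hlt.le
  · exact (hi j hij).le

theorem isPWO_ofLex_fiber (f : Transseries) (k : ℕ) (p : ℕ → ℝ) :
    {t | ∃ n ∈ f.support, (∀ i < k, ofLex n i = p i) ∧ ofLex n k = t}.IsPWO := by
  have hPWO : {n ∈ f.support | ∀ i < k, ofLex n i = p i}.IsPWO :=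
    f.isPWO_support.mono (Set.sep_subset _ _)
  refine (hPWO.image_of_monotoneOn (f := fun n => ofLex n k) ?_).mono
    fun t ⟨n, hn, hp, ht⟩ => ⟨n, ⟨hn, hp⟩, ht⟩
  exact fun n hn n' hn' hle =>
    ofLex_le_of_le hle fun i hi => (hn.2 i hi).trans (hn'.2 i hi).symm

theorem mem_LInfty_two {T : Set ℝ} {μ : ℝ} (hT : IsSequential T)
    (hf : ∀ n ∈ f.support, ∃ γ ∈ T, ∃ r s : ℤ, n = expo γ (μ * γ + r) s) : f ∈ LInfty 2 := by
  refine ⟨fun n hn k hk => ?_, fun k hk p => ?_⟩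
  · obtain ⟨γ, -, r, s, rfl⟩ := hf n hn
    rw [ofLex_expo_apply, if_neg (by omega), if_neg (by omega), if_neg (by omega), add_zero,
      add_zero]
  interval_cases k
  · refine hT.mono ?_
    rintro _ ⟨n, hn, -, rfl⟩
    obtain ⟨γ, hγ, r, s, rfl⟩ := hf n hn
    rwa [ofLex_expo_zero]
  · refine isSequential_of_isPWO (isPWO_ofLex_fiber f 1 p) (θ := μ * p 0) ?_
    rintro _ ⟨n, hn, hp, rfl⟩
    obtain ⟨γ, -, r, s, rfl⟩ := hf n hn
    exact ⟨r, by rw [ofLex_expo_one, ← hp 0 one_pos, ofLex_expo_zero]⟩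
  · refine isSequential_of_isPWO (isPWO_ofLex_fiber f 2 p) (θ := 0) ?_
    rintro _ ⟨n, hn, -, rfl⟩
    obtain ⟨γ, -, r, s, rfl⟩ := hf n hn
    exact ⟨s, by rw [ofLex_expo_two, zero_add]⟩

theorem mem_LInfty_of_le {j k : ℕ} (hf : f ∈ LInfty k) (hjk : j ≤ k)
    (hdepth : ∀ n ∈ f.support, ∀ i, j < i → ofLex n i = 0) : f ∈ LInfty j :=
  ⟨hdepth, fun i hi p => hf.2 i (hi.trans hjk) p⟩

end Classes

/-! ### Exponents of the formal inverse -/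

section Semigroup

variable {g h : Transseries} {α : ℝ} {m : ℤ}

theorem expo_add (a b c a' b' c' : ℝ) :
    expo a b c + expo a' b' c' = expo (a + a') (b + b') (c + c') := by
  simp only [expo, ellExp_add]
  abel

theorem leadExp_expo (a b x y z : ℝ) :
    leadExp a b (expo x y z) = expo (a * x) (b * x + y) z := by
  apply exponent_ext_cases <;> simp [ofLex_leadExp_zero, ofLex_leadExp_one,
    ofLex_leadExp_add_two, ofLex_expo_apply]

/-- The exponent of `x ^ γ * ℓ ^ r * ℓ₂ ^ s`, as an additive function of `(γ, r, s)`. -/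
def expoHom : ℝ × ℤ × ℤ →+ Exponent :=
  AddMonoidHom.mk' (fun p => expo p.1 p.2.1 p.2.2) fun p q => by
    simp only [expo_add, Prod.fst_add, Prod.snd_add, Int.cast_add]

theorem exists_mem_supp_eq_expo (hg : g ∈ LHat) {n : Exponent} (hn : n ∈ g.support) :
    ∃ p ∈ supp g, n = expo p.1 p.2 0 := by
  obtain ⟨z, hz⟩ := hg.2 n hn
  have hexpo : n = expo (ofLex n 0) z 0 := by
    refine exponent_ext_cases ?_ ?_ fun j => ?_
    · rw [ofLex_expo_zero]
    · rw [ofLex_expo_one, hz]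
    · rw [hg.1.1.1 n hn _ (by omega), ofLex_expo_apply]
      simp
  exact ⟨(ofLex n 0, z), show g.coeff (expo (ofLex n 0) z 0) ≠ 0 from hexpo ▸ hn, hexpo⟩

theorem exists_mem_supp_of_mem_support_relRem (hg : g ∈ LHat) (hg0 : g ≠ 0)
    (horder : g.order = expo α m 0) {q : Exponent} (hq : q ∈ (relRem g).support) :
    ∃ p ∈ supp g \ {(α, m)}, q = expoHom (p.1 - α, p.2 - m, 0) := by
  obtain ⟨p, hp, hpq⟩ :=
    exists_mem_supp_eq_expo hg (order_add_mem_support hg0 hq)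
  have hqp : q = expoHom (p.1 - α, p.2 - m, 0) := by
    rw [eq_sub_of_add_eq' hpq, horder, sub_eq_iff_eq_add, expoHom, AddMonoidHom.mk'_apply, expo_add]
    push_cast
    rw [sub_add_cancel, sub_add_cancel, add_zero]
  refine ⟨p, ⟨hp, ?_⟩, hqp⟩
  rintro rfl
  rw [sub_self, sub_self, ← Prod.zero_eq_mk, ← Prod.zero_eq_mk, map_zero] at hqp
  exact (pos_of_mem_support_relRem hg0 hq).ne' hqp

theorem closure_support_relRem_le_map_semigroup (hg : g ∈ LHat) (hg0 : g ≠ 0)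
    (horder : g.order = expo α m 0) :
    AddSubsemigroup.closure ((relRem g).support ∪ {expo 0 1 (-1), expo 0 0 1}) ≤
      (semigroup g α m).map expoHom.toAddHom := by
  refine AddSubsemigroup.closure_le.2 ?_
  rintro q (hq | rfl | rfl)
  · obtain ⟨p, hp, rfl⟩ := exists_mem_supp_of_mem_support_relRem hg hg0 horder hq
    exact ⟨_, AddSubsemigroup.subset_closure (Or.inl ⟨p, hp, rfl⟩), rfl⟩
  · exact ⟨(0, 1, -1), AddSubsemigroup.subset_closure (Or.inr (Or.inl rfl)), by simp [expoHom]⟩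
  · exact ⟨(0, 0, 1), AddSubsemigroup.subset_closure (Or.inr (Or.inr rfl)), by simp [expoHom]⟩

theorem closure_support_relRem_le_map_semigroupZero (hg : g ∈ LHat) (hg0 : g ≠ 0)
    (horder : g.order = expo α (0 : ℤ) 0) :
    AddSubsemigroup.closure ((relRem g).support ∪ {expo 0 1 0}) ≤
      (semigroupZero g α).map
        (expoHom.comp ((AddMonoidHom.id ℝ).prodMap (AddMonoidHom.inl ℤ ℤ))).toAddHom := by
  refine AddSubsemigroup.closure_le.2 ?_
  rintro q (hq | rfl)
  · obtain ⟨p, hp, rfl⟩ := exists_mem_supp_of_mem_support_relRem hg hg0 horder hq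
    exact ⟨_, AddSubsemigroup.subset_closure (Or.inl ⟨p, hp, rfl⟩), by rw [sub_zero]; rfl⟩
  · exact ⟨(0, 1), AddSubsemigroup.subset_closure (Or.inr rfl), by simp [expoHom]⟩

theorem sub_nonneg_of_mem_supp (horder : g.order = expo α m 0) {p : ℝ × ℤ} (hp : p ∈ supp g) :
    0 ≤ p.1 - α := by
  have hle : expo α m 0 ≤ expo p.1 p.2 0 := horder ▸ order_le_of_coeff_ne_zero hp
  have h0 := ofLex_le_of_le hle (j := 0) fun i hi => absurd hi i.not_lt_zero
  rwa [ofLex_expo_zero, ofLex_expo_zero, ← sub_nonneg] at h0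

theorem isSequential_fst_sub (hg : g ∈ LHat) : IsSequential ((fun p => p.1 - α) '' supp g) := by
  refine ((hg.1.1.2 0 zero_le_one 0).image_orderIso (OrderIso.subRight α)).mono ?_
  rintro _ ⟨p, hp, rfl⟩
  exact ⟨p.1, ⟨_, hp, fun i hi => absurd hi i.not_lt_zero, ofLex_expo_zero _ _ _⟩, rfl⟩

theorem fst_mem_closure_of_mem_semigroup {p : ℝ × ℤ × ℤ} (hp : p ∈ semigroup g α m) :
    p.1 ∈ AddSubmonoid.closure ((fun p => p.1 - α) '' supp g) := by
  suffices h : semigroup g α m ≤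
      (AddSubmonoid.closure ((fun p => p.1 - α) '' supp g)).toAddSubsemigroup.comap
        (AddHom.fst ℝ (ℤ × ℤ)) from h hp
  refine AddSubsemigroup.closure_le.2 ?_
  rintro _ (⟨p, hp, rfl⟩ | rfl | rfl)
  · exact AddSubmonoid.subset_closure ⟨p, hp.1, rfl⟩
  all_goals exact (AddSubmonoid.closure ((fun p => p.1 - α) '' supp g)).zero_mem

end Semigroup

section Main

variable {g h : Transseries} {a b α : ℝ} {m : ℤ}

theorem eq_order_or_exists_of_mem_support (hh : h ≠ 0) {n : Exponent} (hn : n ∈ h.support) :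
    n = h.order ∨ ∃ t ∈ (relRem h).support, n = h.order + t := by
  refine or_iff_not_imp_left.2 fun hne => ⟨n - h.order, ?_, (add_sub_cancel _ _).symm⟩
  rwa [← order_add_mem_support_iff hh (sub_ne_zero.2 hne), add_sub_cancel]

theorem inv_rpow_mul_rpow_eq {c a : ℝ} (hc : 0 < c) (ha : 0 < a) (b : ℝ) :
    (c ^ a⁻¹ * a⁻¹ ^ (-b / a))⁻¹ = (c * a ^ b) ^ (-1 / a) := by
  rw [Real.mul_rpow hc.le (Real.rpow_nonneg ha.le b), ← Real.rpow_mul ha.le, mul_inv,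
    ← Real.rpow_neg hc.le, ← Real.inv_rpow (inv_nonneg.2 ha.le), inv_inv]
  congr 2 <;> ring

theorem mem_addSubsemigroup_closure {M : Type*} [AddMonoid M] {S : Set M} {q : M}
    (hq : q ∈ AddSubmonoid.closure S) (hq0 : q ≠ 0) : q ∈ AddSubsemigroup.closure S := by
  refine Or.resolve_left ?_ hq0
  clear hq0
  induction hq using AddSubmonoid.closure_induction with
  | mem q hq => exact Or.inr (AddSubsemigroup.subset_closure hq)
  | zero => exact Or.inl rfl
  | add q q' _ _ h h' =>
    rcases h with rfl | h
    · rwa [zero_add]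
    rcases h' with rfl | h'
    · rw [add_zero]; exact Or.inr h
    · exact Or.inr (add_mem h h')

theorem ofLex_apply_eq_zero_of_mem_closure {S : Set Exponent} {j : ℕ}
    (hS : ∀ q ∈ S, ofLex q j = 0) {q : Exponent} (hq : q ∈ AddSubmonoid.closure S) :
    ofLex q j = 0 := by
  induction hq using AddSubmonoid.closure_induction with
  | mem q hq => exact hS q hq
  | zero => rfl
  | add q q' _ _ h h' => rw [ofLex_add_apply, h, h', add_zero]

theorem ofLex_apply_eq_zero_of_mem_support_relRem {j : ℕ} (hg0 : g ≠ 0)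
    (hg : ∀ n ∈ g.support, ofLex n j = 0) {q : Exponent} (hq : q ∈ (relRem g).support) :
    ofLex q j = 0 := by
  have h := hg _ (order_add_mem_support hg0 hq)
  rwa [ofLex_add_apply, hg _ (HahnSeries.coeff_order_eq_zero.not.2 hg0), zero_add] at h

theorem HasLeading.exists_formalInverse (G : HasLeading g a b)
    (hg : ∀ n ∈ g.support, ∀ j, 1 < j → ofLex n j = 0) {E : Set Exponent} (hE : E.Finite)
    (hpos : ∀ e ∈ E, 0 ≤ e) (hdepth : ∀ e ∈ E, ∀ j, 2 < j → ofLex e j = 0)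
    (hell : ellExp 1 1 ∈ AddSubmonoid.closure E)
    (hb : b = 0 ∨ ellExp 1 1 + ellExp 2 (-1) ∈ AddSubmonoid.closure E)
    (hell2 : (∀ e ∈ E, ofLex e 2 = 0) ∨ ellExp 2 1 ∈ AddSubmonoid.closure E) :
    ∃ h, IsFormalInverse g h ∧ HasLeading h a⁻¹ (-b / a) ∧
      h = HahnSeries.single (expo (1 / a) (-b / a) 0) ((g.leadingCoeff * a ^ b) ^ (-1 / a)) *
        (1 + relRem h) ∧
      ∀ n ∈ (relRem h).support,
        ∃ q ∈ AddSubsemigroup.closure ((relRem g).support ∪ E), n = leadExp a⁻¹ (-b / a) q := by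
  set S := (relRem g).support ∪ E
  have hPWO : (AddSubmonoid.closure S : Set Exponent).IsPWO := by
    refine Set.IsPWO.addSubmonoid_closure ?_ ((relRem g).isPWO_support.union hE.isPWO)
    rintro q (hq | hq)
    exacts [(pos_of_mem_support_relRem G.ne_zero hq).le, hpos q hq]
  have hES : AddSubmonoid.closure E ≤ AddSubmonoid.closure S :=
    AddSubmonoid.closure_mono Set.subset_union_right
  have hS {j : ℕ} (hj : 1 < j) (hEj : ∀ e ∈ E, ofLex e j = 0) {q : Exponent}
      (hq : q ∈ AddSubmonoid.closure S) : ofLex q j = 0 := by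
    refine ofLex_apply_eq_zero_of_mem_closure (fun q hq => hq.elim (fun hq => ?_) (hEj q)) hq
    exact ofLex_apply_eq_zero_of_mem_support_relRem G.ne_zero (fun n hn => hg n hn j hj) hq
  obtain ⟨h, hh, hsupp⟩ := G.exists_left_inverse hPWO
    (Set.subset_union_left.trans AddSubmonoid.subset_closure) (hES hell) (hb.imp_right (@hES _))
    fun q hq hq2 => hES (hell2.resolve_left fun hE2 => hq2 (hS one_lt_two hE2 hq))
  have H := G.of_hom_eq_idT hh
  refine ⟨h, isFormalInverse_of_hom_eq_idT G H hg (fun n hn j hj => ?_) hh, H, ?_, fun n hn => ?_⟩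
  · obtain ⟨q, hq, rfl⟩ := hsupp n hn
    obtain ⟨i, rfl⟩ := Nat.exists_eq_add_of_le' hj.le
    rw [ofLex_leadExp_add_two, ofLex_add_apply, ofLex_ellExp_apply, if_neg (by omega), zero_add,
      hS (one_lt_two.trans hj) (fun e he => hdepth e he _ hj) hq]
  · conv_lhs => rw [eq_single_mul_one_add_relRem H.ne_zero]
    rw [H.order_eq, G.leadingCoeff_of_hom_eq_idT hh,
      inv_rpow_mul_rpow_eq G.leadingCoeff_pos G.pos, one_div]
  · obtain ⟨q, hq, hq0, rfl⟩ := G.exists_eq_leadExp_of_mem_support_relRem hh hsupp hn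
    exact ⟨q, mem_addSubsemigroup_closure hq hq0, rfl⟩

theorem HasLeading.exists_formalInverse_semigroup (hg : g ∈ LHat) (G : HasLeading g α m) :
    ∃ h, IsFormalInverse g h ∧ HasLeading h α⁻¹ (-m / α) ∧
      h = HahnSeries.single (expo (1 / α) (-m / α) 0) ((g.leadingCoeff * α ^ m) ^ (-1 / α)) *
        (1 + relRem h) ∧
      ∀ n ∈ (relRem h).support, ∃ γ : ℝ, ∃ r s : ℤ, (γ, r, s) ∈ semigroup g α m ∧
        n = expo (γ / α) (-m * (γ / α) + r) s := by
  set E : Set Exponent := {expo 0 1 (-1), expo 0 0 1}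
  have hell : ellExp 1 1 + ellExp 2 (-1) ∈ AddSubmonoid.closure E :=
    AddSubmonoid.subset_closure (Or.inl (by rw [expo, ellExp_zero, zero_add]))
  have hell2 : ellExp 2 1 ∈ AddSubmonoid.closure E :=
    AddSubmonoid.subset_closure (Or.inr (by simp [expo, ellExp_zero]))
  have hell1 : ellExp 1 1 ∈ AddSubmonoid.closure E := by
    simpa [add_assoc, ← ellExp_add, ellExp_zero] using add_mem hell hell2
  have hpos : ∀ e ∈ E, 0 ≤ e := by
    rintro e (rfl | rfl)
    · simpa [expo, ellExp_zero] using (ellExp_add_ellExp_succ_pos 1 one_pos (-1)).le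
    · simpa [expo, ellExp_zero] using (ellExp_pos 2 one_pos).le
  have hdepth : ∀ e ∈ E, ∀ j, 2 < j → ofLex e j = 0 := by
    rintro e (rfl | rfl) j hj <;> rw [ofLex_expo_apply] <;> grind
  obtain ⟨h, hI, H, heq, hR⟩ := G.exists_formalInverse hg.1.1.1 (Set.toFinite E) hpos hdepth hell1
    (Or.inr hell) (Or.inr hell2)
  rw [Real.rpow_intCast] at heq
  refine ⟨h, hI, H, heq, fun n hn => ?_⟩
  obtain ⟨q, hq, rfl⟩ := hR n hn
  obtain ⟨⟨γ, r, s⟩, hs, rfl⟩ :=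
    closure_support_relRem_le_map_semigroup hg G.ne_zero G.order_eq hq
  refine ⟨γ, r, s, hs, (leadExp_expo _ _ _ _ _).trans ?_⟩
  congr 1 <;> ring

theorem isSequential_closure_fst_sub (hg : g ∈ LHat) (horder : g.order = expo α m 0) :
    IsSequential (AddSubmonoid.closure ((fun p => p.1 - α) '' supp g)) := by
  refine (isSequential_fst_sub hg).closure ?_
  rintro _ ⟨p, hp, rfl⟩
  exact sub_nonneg_of_mem_supp horder hp

theorem nonneg_of_mem_closure_fst_sub (horder : g.order = expo α m 0) {γ : ℝ}
    (hγ : γ ∈ AddSubmonoid.closure ((fun p => p.1 - α) '' supp g)) : 0 ≤ γ := by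
  refine AddSubmonoid.closure_le (S := AddSubmonoid.nonneg ℝ) |>.2 ?_ hγ
  rintro _ ⟨p, hp, rfl⟩
  exact sub_nonneg_of_mem_supp horder hp

theorem mem_LInfty_two_of_mem_semigroup (hg : g ∈ LHat) (G : HasLeading g α m) {R : Transseries}
    (hR : ∀ n ∈ R.support, ∃ γ : ℝ, ∃ r s : ℤ, (γ, r, s) ∈ semigroup g α m ∧
      n = expo (γ / α) (-m * (γ / α) + r) s) : R ∈ LInfty 2 := by
  refine mem_LInfty_two (((isSequential_closure_fst_sub hg G.order_eq).image_orderIso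
    (OrderIso.divRight₀ α G.pos))) (μ := -m) fun n hn => ?_
  obtain ⟨γ, r, s, hs, rfl⟩ := hR n hn
  exact ⟨γ / α, ⟨γ, fst_mem_closure_of_mem_semigroup hs, rfl⟩, r, s, rfl⟩

theorem mem_LFin_two_of_mem_semigroup (hg : g ∈ LHat) (G : HasLeading g α m)
    (H : HasLeading h α⁻¹ (-m / α))
    (hR : ∀ n ∈ (relRem h).support, ∃ γ : ℝ, ∃ r s : ℤ, (γ, r, s) ∈ semigroup g α m ∧
      n = expo (γ / α) (-m * (γ / α) + r) s) : h ∈ LFin 2 := by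
  set T := AddSubmonoid.closure ((fun p => p.1 - α) '' supp g)
  have hsupp : ∀ n ∈ h.support, ∃ γ ∈ T, ∃ r s : ℤ,
      n = expo ((1 + γ) / α) (-m * ((1 + γ) / α) + r) s := by
    intro n hn
    rcases eq_order_or_exists_of_mem_support H.ne_zero hn with rfl | ⟨t, ht, rfl⟩
    · refine ⟨0, T.zero_mem, 0, 0, ?_⟩
      rw [H.order_eq]
      congr 1 <;> push_cast <;> ring
    · obtain ⟨γ, r, s, hs, rfl⟩ := hR t ht
      refine ⟨γ, fst_mem_closure_of_mem_semigroup hs, r, s, ?_⟩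
      rw [H.order_eq, expo_add]
      congr 1 <;> ring
  refine ⟨mem_LInfty_two ((isSequential_closure_fst_sub hg G.order_eq).image_orderIso
    ((OrderIso.addLeft 1).trans (OrderIso.divRight₀ α G.pos))) (μ := -m) ?_, fun n hn => ?_⟩
  · intro n hn
    obtain ⟨γ, hγ, r, s, rfl⟩ := hsupp n hn
    exact ⟨(1 + γ) / α, ⟨γ, hγ, rfl⟩, r, s, rfl⟩
  · obtain ⟨γ, hγ, r, s, rfl⟩ := hsupp n hn
    rw [ofLex_expo_zero]
    exact div_pos (by linarith [nonneg_of_mem_closure_fst_sub G.order_eq hγ]) G.pos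

theorem IsFormalInverse.mem_semigroupZero (hI : IsFormalInverse g h) (hg : g ∈ LHat)
    (G : HasLeading g α (0 : ℤ)) {n : Exponent} (hn : n ∈ (relRem h).support) :
    ∃ γ : ℝ, ∃ r : ℤ, (γ, r) ∈ semigroupZero g α ∧ n = expo (γ / α) r 0 := by
  set E : Set Exponent := {expo 0 1 0}
  have hE : expo 0 1 0 = ellExp 1 1 := by simp [expo, ellExp_zero]
  have hdepth : ∀ e ∈ E, ∀ j, 1 < j → ofLex e j = 0 := by
    rintro _ rfl j hj
    rw [hE, ofLex_ellExp_apply, if_neg hj.ne]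
  obtain ⟨h', hI', -, -, hR⟩ := G.exists_formalInverse hg.1.1.1 (Set.finite_singleton _)
    (by rintro _ rfl; exact hE ▸ (ellExp_pos 1 one_pos).le)
    (fun e he j hj => hdepth e he j (one_lt_two.trans hj))
    (AddSubmonoid.subset_closure hE.symm) (Or.inl Int.cast_zero)
    (Or.inl fun e he => hdepth e he 2 one_lt_two)
  obtain ⟨q, hq, rfl⟩ := hR n (hI.unique G hI' ▸ hn)
  obtain ⟨⟨γ, r⟩, hs, rfl⟩ :=
    closure_support_relRem_le_map_semigroupZero hg G.ne_zero G.order_eq hq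
  refine ⟨γ, r, hs, (leadExp_expo _ _ _ _ _).trans ?_⟩
  congr 1
  · exact inv_mul_eq_div α γ
  · simp
  · simp

theorem mem_LHatInfty_of_support (hf : g ∈ LInfty 2)
    (hsupp : ∀ n ∈ g.support, ∃ γ : ℝ, ∃ r : ℤ, n = expo γ r 0) : g ∈ LHatInfty := by
  refine ⟨mem_LInfty_of_le hf one_le_two fun n hn i hi => ?_, fun n hn => ?_⟩
  · obtain ⟨γ, r, rfl⟩ := hsupp n hn
    rw [ofLex_expo_apply]
    grind
  · obtain ⟨γ, r, rfl⟩ := hsupp n hn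
    exact ⟨r, ofLex_expo_one _ _ _⟩

theorem mem_LHat_of_support (hf : g ∈ LFin 2)
    (hsupp : ∀ n ∈ g.support, ∃ γ : ℝ, ∃ r : ℤ, n = expo γ r 0) : g ∈ LHat :=
  have h := mem_LHatInfty_of_support hf.1 hsupp
  ⟨⟨h.1, hf.2⟩, h.2⟩

theorem exists_eq_expo_of_mem_support (H : HasLeading h b (0 : ℤ))
    (hR : ∀ n ∈ (relRem h).support, ∃ γ : ℝ, ∃ r : ℤ, n = expo γ r 0) :
    ∀ n ∈ h.support, ∃ γ : ℝ, ∃ r : ℤ, n = expo γ r 0 := by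
  intro n hn
  rcases eq_order_or_exists_of_mem_support H.ne_zero hn with rfl | ⟨t, ht, rfl⟩
  · exact ⟨b, 0, H.order_eq⟩
  · obtain ⟨γ, r, rfl⟩ := hR t ht
    exact ⟨b + γ, r, by rw [H.order_eq, expo_add, Int.cast_zero, zero_add, zero_add]⟩

end Main

end LogTransseries

end

open LogTransseries in
theorem proposition5p1 (g : Transseries) (hg : g ∈ LHat) (a α : ℝ) (m : ℤ)
    (ha : 0 < a) (hα : 0 < α)
    (hcoeff : g.leadingCoeff = a) (horder : g.order = expo α m 0) :
    ∃ ginv : Transseries,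
      IsFormalInverse g ginv ∧
      (∀ h : Transseries, IsFormalInverse g h → h = ginv) ∧
      ginv ∈ LFin 2 ∧
      (m = 0 → ginv ∈ LHat) ∧
      (m ≠ 0 → ∃ R ∈ LInfty 2,
        ginv = HahnSeries.single (expo (1 / α) (-m / α) 0) ((a * α ^ m) ^ (-1 / α)) * (1 + R) ∧
        0 < R.orderTop ∧
        ∀ n ∈ R.support, ∃ γ : ℝ, ∃ r s : ℤ, (γ, r, s) ∈ semigroup g α m ∧
          n = expo (γ / α) (-m * (γ / α) + r) s) ∧
      (m = 0 → ∃ R ∈ LHatInfty,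
        ginv = HahnSeries.single (expo (1 / α) 0 0) (a ^ (-1 / α)) * (1 + R) ∧
        0 < R.orderTop ∧
        ∀ n ∈ R.support, ∃ γ : ℝ, ∃ r : ℤ, (γ, r) ∈ semigroupZero g α ∧
          n = expo (γ / α) r 0) := by
  have G : HasLeading g α m := ⟨hcoeff ▸ ha, horder, hα⟩
  obtain ⟨h, hI, H, heq, hR⟩ := G.exists_formalInverse_semigroup hg
  rw [hcoeff] at heq
  have hRpos : 0 < (relRem h).orderTop := orderTop_relRem_pos H.ne_zero
  have hRclass : relRem h ∈ LInfty 2 := mem_LInfty_two_of_mem_semigroup hg G hR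
  have hclass : h ∈ LFin 2 := mem_LFin_two_of_mem_semigroup hg G H hR
  refine ⟨h, hI, fun h' hI' => hI'.unique G hI, hclass, ?_,
    fun _ => ⟨relRem h, hRclass, heq, hRpos, hR⟩, ?_⟩
  · rintro rfl
    rw [Int.cast_zero, neg_zero, zero_div, ← Int.cast_zero] at H
    refine mem_LHat_of_support hclass (exists_eq_expo_of_mem_support H fun n hn => ?_)
    obtain ⟨γ, r, -, hn⟩ := hI.mem_semigroupZero hg G hn
    exact ⟨γ / α, r, hn⟩
  · rintro rfl
    rw [Int.cast_zero, neg_zero, zero_div, zpow_zero, mul_one] at heq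
    have hR0 := fun n => hI.mem_semigroupZero hg G (n := n)
    refine ⟨relRem h, mem_LHatInfty_of_support hRclass fun n hn => ?_, heq, hRpos, hR0⟩
    obtain ⟨γ, r, -, hn⟩ := hR0 n hn
    exact ⟨γ / α, r, hn⟩
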